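/- There are sequences $\epsilon(n) \in \mathbb{R}$ and $D(n) \in \mathbb{N}$ with $\epsilon(n) \le \ln n$ for all large $n$, $\epsilon(n) = \ln n - O(\ln\ln n)$, and $D(n) = \Theta(n/\log^k n)$ for some constant $k \in \mathbb{N}$, such that no public-coin $(\epsilon, n^{-\omega(1)})$-locally differentially private protocol solves $\mathsf{CountDistinct}_{n,D}$ with error $o(D)$. Precisely: for every $\delta(n) \le n^{-\omega(1)}$ and every $e(n) = o(D(n))$, for all sufficiently large $n$ no public-coin $(\epsilon(n),\delta(n))$-locally differentially private protocol on $n$ users with inputs in $[D(n)]$ solves $\mathsf{CountDistinct}_{n,D(n)}$ with error $e(n)$. Here a public-coin local protocol on $n$ users with inputs in $[D]$ draws a public random string $\alpha \in \{0,1\}^*$ from a fixed distribution $\mathcal{D}_{\mathrm{pub}}$; given $\alpha$, each user $i$ independently applies the same randomizer $R_\alpha$ to their input $x_i\in[D]$ and sends the resulting message, a random element of an arbitrary measurable space $\mathcal{M}$; and a randomized analyzer $A_\alpha$ maps the tuple of the $n$ messages to a real number. The protocol is $(\epsilon,\delta)$-locally differentially private if for all $x,x'\in[D]$ and every measurable $S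 \subseteq \{0,1\}^*\times\mathcal{M}$, $\Pr[(\alpha,R_\alpha(x))\in S] \le e^{\epsilon}\Pr[(\alpha,R_\alpha(x'))\in S]+\delta$. It solves $\mathsf{CountDistinct}_{n,D}$ with error $e$ if for every $(x_1,\dots,x_n)\in[D]^n$, with probability at least $0.99$ over all the randomness, its output differs from $|\{x_1,\dots,x_n\}|$ by at most $e$. -/

import Mathlib

open MeasureTheory ProbabilityTheory Filter Asymptotics
open scoped ENNReal

universe u

/-- A (non-interactive) public-coin local protocol on `n` users with inputs from `X` and messages
in the measurable space `M`. The public coins are a finite bit string with distribution `pub`,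
which is given to the users and to the analyzer. Given the public string `a`, every user applies
the same private randomizer `R a` to their own input, and the analyzer applies `A a` to the tuple
of all `n` messages and outputs a (random) real number. -/
structure PublicCoinLocalProtocol (n : ℕ) (X : Type) (M : Type u) [MeasurableSpace M] where
  /-- the distribution of the public random string -/
  pub : PMF (List Bool)
  /-- the randomizer: the law of the message, given the public string and the user's input -/
  R : List Bool → X → ProbabilityMeasure M
  /-- the analyzer: the law of the output, given the public string and the transcript -/
  A : List Bool → Kernel (Fin n → M) ℝ
  /-- the analyzer always outputs something -/
  markov : ∀ a, IsMarkovKernel (A a)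

namespace PublicCoinLocalProtocol

variable {n : ℕ} {X : Type} {M : Type u} [MeasurableSpace M]

/-- The probability that `(a, R a x)` lies in `{(a, m) | m ∈ S a}`, where `a` is drawn from the
public distribution. -/
noncomputable def viewProb (P : PublicCoinLocalProtocol n X M) (x : X)
    (S : List Bool → Set M) : ℝ≥0∞ :=
  ∑' a, P.pub a * (P.R a x : Measure M) (S a)

/-- `(ε, δ)`-differential privacy in the public-coin local model: the randomized map
`x ↦ (a, R a x)`, with `a` drawn from the public distribution, is `(ε, δ)`-DP. Any two inputs of a
single user are neighbouring. There are countably many strings, so the events of the pair are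
exactly the sets all of whose sections `S a` are measurable. -/
def IsLocallyDP (P : PublicCoinLocalProtocol n X M) (ε δ : ℝ) : Prop :=
  ∀ x x' : X, ∀ S : List Bool → Set M, (∀ a, MeasurableSet (S a)) →
    P.viewProb x S ≤ ENNReal.ofReal (Real.exp ε) * P.viewProb x' S + ENNReal.ofReal δ

/-- The law of the output of the protocol on the dataset `x`: draw the public string, let all
users randomize their inputs independently, and apply the analyzer. -/
noncomputable def output (P : PublicCoinLocalProtocol n X M) (x : Fin n → X) : Measure ℝ :=
  Measure.sum fun a =>
    P.pub a • (Measure.pi fun i => (P.R a (x i) : Measure M)).bind (P.A a)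

/-- The number of distinct elements in a dataset. -/
noncomputable def countDistinct (x : Fin n → X) : ℕ := (Set.range x).ncard

/-- The protocol counts distinct elements with error `e`: on every dataset, with probability at
least `0.99`, the output differs from the number of distinct elements by at most `e`. -/
def SolvesCountDistinct (P : PublicCoinLocalProtocol n X M) (e : ℝ) : Prop :=
  ∀ x : Fin n → X,
    ENNReal.ofReal 0.99 ≤ P.output x {v : ℝ | |v - (countDistinct x : ℝ)| ≤ e}

end PublicCoinLocalProtocol

/-- `δ n = n ^ (-ω(1))`, as an upper bound. -/
def IsSuperpolynomiallySmall (δ : ℕ → ℝ) : Prop :=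
  ∃ g : ℕ → ℝ, Tendsto g atTop atTop ∧ ∀ᶠ n : ℕ in atTop, δ n ≤ (n : ℝ) ^ (-g n)

/-! The obstruction is moment matching. Two probability vectors `u`, `v` on `{0, …, 4d² + 1}` share
all binomial moments up to order `d`, yet `u` has mass at least `1/2` at `0` and `v` has none
(`exists_moment_matching_weights`). Draw independent multiplicities for the nonzero elements from
`u` or from `v`, fill up with copies of `0`, and shuffle the users. Under `v` every element occurs;
under `u`, with probability at least `1/3`, at least a quarter of the nonzero elements are missing.
An accurate protocol must tell the two cases apart.

A private protocol cannot. By `exists_dominated`, at a cost of `2nδ`, every randomizer has a density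
`f ≤ C` relative to the randomizer of `0`, where `C` is about `2e^ε`. After shuffling, only the
number `k` of copies of an element matters, and averaging the likelihood ratio `∏ f` over
`k`-subsets of `m` zeros gives a combination of `k.choose j` with coefficients independent of `k`.
By orthogonality of the products of `f - 1`, the coefficient of order `j` is at most `√(C^j /
m.choose j)` (`abs_sum_mul_average_le`). Orders up to `d` cancel between `u` and `v`; the rest is at
most `4^(-d)` when `m ≥ 32CK³`, where `K = 4d² + 1` (`sum_range_mul_sqrt_le`).

Exchanging the elements one at a time (`abs_sum_prod_sub_prod_mul_le`) costs at most `D · 4^(-d)`.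
With `d ≈ ln n` this is negligible, while `CK³` stays below `n` up to a constant as soon as `e^ε = n
/ (ln n)^7`. -/

/-! ### Signed weights with vanishing moments. -/

open scoped Nat in
theorem two_mul_sq_mul_prod_sq_sub_sq (j n : ℕ) (hj : 1 ≤ j) :
    2 * (j : ℝ) ^ 2 * ∏ i ∈ (Finset.Icc 1 (j + n)).erase j, |(j : ℝ) ^ 2 - (i : ℝ) ^ 2| =
      n ! * (2 * j + n)! := by
  induction n with
  | zero =>
    obtain ⟨m, rfl⟩ : ∃ m, j = m + 1 := ⟨j - 1, by omega⟩
    have h1 : (Finset.Icc 1 (m + 1 + 0)).erase (m + 1) = Finset.Ico 1 (m + 1) := by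
      grind
    -- For `n = 0` only nodes below `j` remain; factoring `j² - i² = (j - i)(j + i)` gives closed
    -- forms for all partial products, which makes an induction possible.
    have h2 : ∀ l ≤ m, (∏ i ∈ Finset.Ico 1 (l + 1),
        |((m + 1 : ℕ) : ℝ) ^ 2 - (i : ℝ) ^ 2|) * ((m - l)! * (m + 1)!) = m ! * (m + 1 + l)! := by
      intro l
      induction l with
      | zero => intro; simp
      | succ l ih =>
        intro hl
        have := ih (by omega)
        obtain ⟨q, rfl⟩ : ∃ q, m = l + 1 + q := ⟨m - (l + 1), by omega⟩
        rw [Finset.prod_Ico_succ_top (by omega)]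
        have e1 : l + 1 + q - l = q + 1 := by omega
        have e2 : l + 1 + q - (l + 1) = q := by omega
        rw [e1, Nat.factorial_succ q] at this
        rw [e2, show l + 1 + q + 1 + (l + 1) = (l + 1 + q + 1 + l) + 1 by ring,
          Nat.factorial_succ (l + 1 + q + 1 + l), abs_of_nonneg]
        · push_cast at this ⊢
          linear_combination this * ((l : ℝ) + 1 + q + 1 + l + 1)
        · push_cast
          nlinarith [(Nat.cast_nonneg q : (0 : ℝ) ≤ q), (Nat.cast_nonneg l : (0 : ℝ) ≤ l)]
    have h3 := h2 m le_rfl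
    rw [h1, show 2 * (m + 1) + 0 = (m + 1 + m) + 1 by ring, Nat.factorial_succ (m + 1 + m)]
    have hm : ((m ! : ℕ) : ℝ) ≠ 0 := by positivity
    rw [Nat.factorial_succ m] at h3
    refine mul_left_cancel₀ hm ?_
    push_cast at h3 ⊢
    simp only [Nat.sub_self, Nat.factorial_zero, Nat.cast_one] at h3 ⊢
    linear_combination 2 * ((m : ℝ) + 1) * h3
  | succ n ih =>
    have h1 : (Finset.Icc 1 (j + (n + 1))).erase j =
        insert (j + n + 1) ((Finset.Icc 1 (j + n)).erase j) := by
      ext; simp; omega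
    rw [h1, Finset.prod_insert (by simp), Nat.factorial_succ n,
      show 2 * j + (n + 1) = (2 * j + n) + 1 by ring, Nat.factorial_succ (2 * j + n), abs_sub_comm,
      abs_of_nonneg]
    · push_cast
      linear_combination ih * (n + 1) * (2 * (j : ℝ) + n + 1)
    · push_cast
      nlinarith [(Nat.cast_nonneg n : (0 : ℝ) ≤ n), (Nat.cast_nonneg j : (0 : ℝ) ≤ j)]

-- Comparing both sides with `(2(j + n))!`, this says that no binomial coefficient exceeds the
-- central one.
open scoped Nat in
theorem factorial_sq_le (j n : ℕ) : (j + n)! ^ 2 ≤ n ! * (2 * j + n)! := by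
  have h1 := Nat.choose_mul_factorial_mul_factorial (show n ≤ 2 * (j + n) by omega)
  have h2 := Nat.choose_mul_factorial_mul_factorial (show j + n ≤ 2 * (j + n) by omega)
  rw [show 2 * (j + n) - n = 2 * j + n by omega] at h1
  rw [show 2 * (j + n) - (j + n) = j + n by omega] at h2
  have h3 := Nat.choose_le_centralBinom n (j + n)
  rw [Nat.centralBinom] at h3
  have h4 : 0 < (2 * (j + n)).choose (j + n) := Nat.choose_pos (by omega)
  refine Nat.le_of_mul_le_mul_left ?_ h4
  calc (2 * (j + n)).choose (j + n) * (j + n)! ^ 2 = (2 * (j + n)).choose n * n ! * (2 * j + n)! := by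
        rw [h1, ← h2]; ring
    _ ≤ _ := by rw [mul_assoc]; exact Nat.mul_le_mul_right _ h3

/-- The nodes `0, 1, 4, 16, 36, …, 4 d²`. -/
def quadraticNodes (d : ℕ) : Finset ℕ := insert 0 (insert 1 ((Finset.Icc 1 d).image fun i => 4 * i ^ 2))

theorem card_quadraticNodes (d : ℕ) : (quadraticNodes d).card = d + 2 := by
  rw [quadraticNodes, Finset.card_insert_of_notMem, Finset.card_insert_of_notMem,
    Finset.card_image_of_injective]
  · simp
  · intro a b h
    simpa using h
  · simp
  · simp

open scoped Nat in
theorem prod_quadraticNodes_zero (d : ℕ) :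
    ∏ r ∈ (quadraticNodes d).erase 0, |((0 : ℕ) : ℝ) - (r : ℝ)| = 4 ^ d * (d ! : ℝ) ^ 2 := by
  have h1 : (quadraticNodes d).erase 0 = insert 1 ((Finset.Icc 1 d).image fun i => 4 * i ^ 2) := by
    rw [quadraticNodes, Finset.erase_insert]
    simp
  rw [h1, Finset.prod_insert (by simp), Finset.prod_image (by intro a _ b _ h; simpa using h)]
  induction d with
  | zero => simp
  | succ d ih =>
    have ih := ih (by rw [quadraticNodes, Finset.erase_insert]; simp)
    rw [Finset.prod_Icc_succ_top (by omega), ← mul_assoc, ih, Nat.factorial_succ, Nat.cast_zero, zero_sub, abs_neg]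
    push_cast
    rw [abs_of_nonneg (by positivity)]
    ring

-- This bounds the weight at `4j²`, relative to that at `0`, by `2 / (4j² - 1)`. The extra node `1`
-- supplies the factor `4j² - 1`; the square nodes alone would only give a constant bound for each
-- weight, which does not sum.
open scoped Nat in
theorem prod_quadraticNodes_sq (d j : ℕ) (hj : 1 ≤ j) (hjd : j ≤ d) :
    (4 * (j : ℝ) ^ 2 - 1) / 2 * (4 ^ d * (d ! : ℝ) ^ 2) ≤
      ∏ r ∈ (quadraticNodes d).erase (4 * j ^ 2), |((4 * j ^ 2 : ℕ) : ℝ) - (r : ℝ)| := by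
  have h1 : (quadraticNodes d).erase (4 * j ^ 2) =
      insert 0 (insert 1 (((Finset.Icc 1 d).erase j).image fun i => 4 * i ^ 2)) := by
    rw [quadraticNodes, Finset.erase_insert_of_ne (by positivity), Finset.erase_insert_of_ne (by omega),
      Finset.image_erase]
    intro a b h
    simpa using h
  obtain ⟨n, rfl⟩ := Nat.exists_eq_add_of_le hjd
  have hj' : (1 : ℝ) ≤ j := by exact_mod_cast hj
  have h0 : (0 : ℝ) ≤ 4 * (j : ℝ) ^ 2 - 1 := by nlinarith
  rw [h1, Finset.prod_insert (by simp), Finset.prod_insert (by simp),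
    Finset.prod_image (by intro a _ b _ h; simpa using h)]
  have h2 : ∀ i : ℕ, |((4 * j ^ 2 : ℕ) : ℝ) - ((4 * i ^ 2 : ℕ) : ℝ)| = 4 * |(j : ℝ) ^ 2 - (i : ℝ) ^ 2| := by
    intro i
    push_cast
    rw [← mul_sub, abs_mul, abs_of_pos (by norm_num : (0 : ℝ) < 4)]
  simp_rw [h2]
  rw [Finset.prod_mul_distrib, Finset.prod_const, Finset.card_erase_of_mem (by simp; omega), Nat.card_Icc,
    Nat.add_sub_cancel]
  push_cast
  rw [sub_zero, abs_of_nonneg (by positivity), abs_of_nonneg h0]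
  have h3 := two_mul_sq_mul_prod_sq_sub_sq j n hj
  have h4 : (((j + n)! : ℕ) : ℝ) ^ 2 ≤ (n ! : ℝ) * ((2 * j + n)! : ℝ) := by
    exact_mod_cast factorial_sq_le j n
  rw [← h3] at h4
  obtain ⟨q, rfl⟩ : ∃ q, j = q + 1 := ⟨j - 1, by omega⟩
  rw [show q + 1 + n - 1 = q + n by omega]
  calc _ ≤ (4 * ((q + 1 : ℕ) : ℝ) ^ 2 - 1) / 2 * (4 ^ (q + 1 + n) * (2 * ((q + 1 : ℕ) : ℝ) ^ 2 * ∏ i ∈ (Finset.Icc 1 (q + 1 + n)).erase (q + 1), |((q + 1 : ℕ) : ℝ) ^ 2 - (i : ℝ) ^ 2|)) := by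
        gcongr
    _ = _ := by push_cast; ring

/-- The sum telescopes, since `2 / (4j² - 1) = 1 / (2j - 1) - 1 / (2j + 1)`. -/
theorem sum_two_div_four_mul_sq_sub_one_le (d : ℕ) :
    ∑ j ∈ Finset.Icc 1 d, 2 / (4 * (j : ℝ) ^ 2 - 1) ≤ 1 := by
  have : ∑ j ∈ Finset.Icc 1 d, 2 / (4 * (j : ℝ) ^ 2 - 1) = 1 - 1 / (2 * (d : ℝ) + 1) := by
    induction d with
    | zero => simp
    | succ d ih =>
      rw [Finset.sum_Icc_succ_top (by omega), ih]
      have h0 : (0 : ℝ) ≤ d := by positivity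
      have h1 : 4 * ((d + 1 : ℕ) : ℝ) ^ 2 - 1 ≠ 0 := by push_cast; nlinarith
      push_cast at h1 ⊢
      have h2 : (2 * ((d : ℝ) + 1) + 1) ≠ 0 := by positivity
      field_simp
      ring
  rw [this]
  have : (0 : ℝ) ≤ 1 / (2 * (d : ℝ) + 1) := by positivity
  linarith

/-- A signed measure of small total variation, with an atom of mass `1` at `0`, whose moments up to
order `d` vanish. -/
theorem exists_signed_weights (d : ℕ) : ∃ w : ℕ → ℝ, w 0 = 1 ∧
    ∑ k ∈ Finset.range (4 * d ^ 2 + 2), |w k| ≤ 4 ∧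
    ∀ p : Polynomial ℝ, p.natDegree ≤ d →
      ∑ k ∈ Finset.range (4 * d ^ 2 + 2), w k * p.eval (k : ℝ) = 0 := by
  classical
  set s := quadraticNodes d with hs
  set W : ℕ → ℝ := fun t => ∏ r ∈ s.erase t, ((t : ℝ) - (r : ℝ)) with hW
  have hsub : s ⊆ Finset.range (4 * d ^ 2 + 2) := by
    intro t ht
    simp only [hs, quadraticNodes, Finset.mem_insert, Finset.mem_image, Finset.mem_Icc] at ht
    rw [Finset.mem_range]
    rcases ht with rfl | rfl | ⟨a, ha, rfl⟩
    · omega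
    · omega
    · have : a ^ 2 ≤ d ^ 2 := Nat.pow_le_pow_left ha.2 2
      omega
  have h0s : 0 ∈ s := by simp [hs, quadraticNodes]
  have hW0 : ∀ t, W t ≠ 0 := by
    intro t
    rw [hW, Finset.prod_ne_zero_iff]
    intro r hr
    rw [sub_ne_zero]
    exact_mod_cast (Finset.ne_of_mem_erase hr).symm
  have hsum : ∀ p : Polynomial ℝ, p.natDegree ≤ d → ∑ t ∈ s, p.eval (t : ℝ) / W t = 0 := by
    intro p hp
    -- With `d + 2` nodes, this sum is the coefficient of degree `d + 1` of the interpolant, which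
    -- is `p` itself.
    have := Lagrange.coeff_eq_sum (s := s) (v := fun t : ℕ => (t : ℝ))
      (fun a _ b _ h => Nat.cast_injective h) (P := p)
      (lt_of_le_of_lt Polynomial.degree_le_natDegree
        (by rw [card_quadraticNodes]; exact_mod_cast (by omega : p.natDegree < d + 2)))
    rw [card_quadraticNodes, Polynomial.coeff_eq_zero_of_natDegree_lt (by omega)] at this
    exact this.symm
  set w : ℕ → ℝ := fun t => if t ∈ s then W 0 / W t else 0 with hw
  have hconv : ∀ f : ℕ → ℝ, (∀ t ∉ s, f t = 0) → ∑ k ∈ Finset.range (4 * d ^ 2 + 2), f k = ∑ k ∈ s, f k :=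
    fun f hf => (Finset.sum_subset hsub fun x _ hx => hf x hx).symm
  have hp : ∀ p : Polynomial ℝ, p.natDegree ≤ d → ∑ t ∈ s, w t * p.eval (t : ℝ) = 0 := by
    intro p hp
    have : ∑ t ∈ s, w t * p.eval (t : ℝ) = W 0 * ∑ t ∈ s, p.eval (t : ℝ) / W t := by
      rw [Finset.mul_sum]
      refine Finset.sum_congr rfl fun t ht => ?_
      simp only [hw, ht, if_true]
      ring
    rw [this, hsum p hp, mul_zero]
  have hw0 : w 0 = 1 := by simp only [hw, h0s, if_true]; exact div_self (hW0 0)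
  have hsplit : ∀ f : ℕ → ℝ, ∑ t ∈ s, f t = f 0 + (f 1 + ∑ j ∈ Finset.Icc 1 d, f (4 * j ^ 2)) := by
    intro f
    rw [hs, quadraticNodes, Finset.sum_insert (by simp), Finset.sum_insert (by simp),
      Finset.sum_image (by intro a _ b _ h; simpa using h)]
  have hwj : ∑ j ∈ Finset.Icc 1 d, |w (4 * j ^ 2)| ≤ 1 := by
    refine le_trans (Finset.sum_le_sum fun j hj => ?_) (sum_two_div_four_mul_sq_sub_one_le d)
    rw [Finset.mem_Icc] at hj
    have hjs : 4 * j ^ 2 ∈ s := by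
      simp only [hs, quadraticNodes, Finset.mem_insert, Finset.mem_image, Finset.mem_Icc]
      exact Or.inr (Or.inr ⟨j, hj, rfl⟩)
    simp only [hw, hjs, if_true]
    have h1 := prod_quadraticNodes_zero d
    have h2 := prod_quadraticNodes_sq d j hj.1 hj.2
    rw [← h1, ← Finset.abs_prod, ← Finset.abs_prod] at h2
    have h3 : (0 : ℝ) < 4 * (j : ℝ) ^ 2 - 1 := by
      have : (1 : ℝ) ≤ j := by exact_mod_cast hj.1
      nlinarith
    rw [abs_div, div_le_div_iff₀ (abs_pos.2 (hW0 _)) h3]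
    change (4 * (j : ℝ) ^ 2 - 1) / 2 * |W 0| ≤ |W (4 * j ^ 2)| at h2
    linarith
  -- The weights sum to zero, so the weight at `1` is determined by the others. The total variation
  -- is then at most `1 + 2 + 1`.
  have hw1 : |w 1| ≤ 2 := by
    have h1 := hp 1 (by simp)
    simp only [Polynomial.eval_one, mul_one] at h1
    rw [hsplit, hw0] at h1
    have h2 := (Finset.abs_sum_le_sum_abs (fun j => w (4 * j ^ 2)) (Finset.Icc 1 d)).trans hwj
    rw [abs_le] at h2 ⊢
    constructor <;> linarith
  refine ⟨w, hw0, ?_, ?_⟩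
  · rw [hconv _ (fun t ht => by simp [hw, ht]), hsplit, hw0]
    norm_num
    linarith
  · intro p hpd
    rw [hconv _ (fun t ht => by simp [hw, ht]), hp p hpd]

/-- Two probability vectors on `{0, …, 4 d² + 1}` with the same binomial moments up to order `d`,
one without and one with a large atom at `0`. -/
theorem exists_moment_matching_weights (d : ℕ) : ∃ u v : ℕ → ℝ, (∀ k, 0 ≤ u k) ∧ (∀ k, 0 ≤ v k) ∧
    ∑ k ∈ Finset.range (4 * d ^ 2 + 2), u k = 1 ∧ ∑ k ∈ Finset.range (4 * d ^ 2 + 2), v k = 1 ∧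
    v 0 = 0 ∧ 1 / 2 ≤ u 0 ∧
    ∀ j ≤ d, ∑ k ∈ Finset.range (4 * d ^ 2 + 2), (u k - v k) * (k.choose j : ℝ) = 0 := by
  obtain ⟨w, hw0, hw4, hwp⟩ := exists_signed_weights d
  set I := Finset.range (4 * d ^ 2 + 2)
  have h0I : 0 ∈ I := by simp [I]
  -- The positive and negative parts of `w` have the same mass `S`, between `1` and `2`; normalizing
  -- them gives `u` and `v`, and `u 0 = 1 / S ≥ 1 / 2`.
  set S := ∑ k ∈ I, (w k)⁺ with hS
  have hS1 : 1 ≤ S := by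
    have := Finset.single_le_sum (f := fun k => (w k)⁺) (fun k _ => posPart_nonneg _) h0I
    simpa [hw0] using this
  have hw1 : ∑ k ∈ I, w k = 0 := by simpa using hwp 1 (by simp)
  have hneg : ∑ k ∈ I, (w k)⁻ = S := by
    have : ∑ k ∈ I, w k = S - ∑ k ∈ I, (w k)⁻ := by
      rw [hS, ← Finset.sum_sub_distrib]
      exact Finset.sum_congr rfl fun k _ => (posPart_sub_negPart _).symm
    linarith
  have hS2 : S ≤ 2 := by
    have : ∑ k ∈ I, |w k| = S + S := by
      nth_rewrite 2 [← hneg]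
      rw [hS, ← Finset.sum_add_distrib]
      exact Finset.sum_congr rfl fun k _ => (posPart_add_negPart _).symm
    linarith
  have hSpos : 0 < S := by linarith
  refine ⟨fun k => (w k)⁺ / S, fun k => (w k)⁻ / S, fun k => by positivity, fun k => by positivity, ?_, ?_, ?_, ?_, ?_⟩
  · rw [← Finset.sum_div, div_self hSpos.ne']
  · rw [← Finset.sum_div, hneg, div_self hSpos.ne']
  · simp [hw0]
  · simp only [hw0]
    rw [div_le_div_iff₀ (by norm_num) hSpos]
    simp; linarith
  · intro j hj
    have := hwp (descPochhammer ℝ j) (by rw [descPochhammer_natDegree]; exact hj)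
    simp_rw [descPochhammer_eval_eq_descFactorial, Nat.descFactorial_eq_factorial_mul_choose] at this
    have hj0 : ((j.factorial : ℕ) : ℝ) ≠ 0 := by positivity
    refine mul_left_cancel₀ (mul_ne_zero hj0 hSpos.ne') ?_
    rw [mul_zero, ← this, Finset.mul_sum]
    refine Finset.sum_congr rfl fun k _ => ?_
    rw [← sub_div, posPart_sub_negPart]
    push_cast
    field_simp

/-! ### Hybrid argument for product distributions. -/

/-- Replacing the factors of a product distribution one at a time. -/
theorem abs_sum_prod_sub_prod_mul_le {α : Type*} [Fintype α] {u v : α → ℝ} (hu : ∀ a, 0 ≤ u a)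
    (hv : ∀ a, 0 ≤ v a) (hu1 : ∑ a, u a = 1) (hv1 : ∑ a, v a = 1) {η : ℝ} (m : ℕ)
    (Φ : (Fin m → α) → ℝ)
    (h : ∀ i N, |∑ a, (u a - v a) * Φ (Function.update N i a)| ≤ η) :
    |∑ N : Fin m → α, ((∏ i, u (N i)) - ∏ i, v (N i)) * Φ N| ≤ m * η := by
  induction m with
  | zero => simp
  | succ m ih =>
    have hsplit : ∀ f : (Fin (m + 1) → α) → ℝ, ∑ N, f N = ∑ a, ∑ N : Fin m → α, f (Fin.cons a N) := by
      intro f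
      rw [← Fintype.sum_prod_type']
      exact (Fintype.sum_equiv (Fin.consEquiv fun _ => α) _ _ fun _ => rfl).symm
    have hprod : ∑ N : Fin m → α, ∏ i, v (N i) = 1 := by
      rw [← Fintype.prod_sum]; simp [hv1]
    -- First exchange the tail with the head still drawn from `u`, then the head with the tail
    -- already drawn from `v`.
    have key : ∑ N : Fin (m + 1) → α, ((∏ i, u (N i)) - ∏ i, v (N i)) * Φ N =
        (∑ a, u a * ∑ N : Fin m → α, ((∏ i, u (N i)) - ∏ i, v (N i)) * Φ (Fin.cons a N)) +
        ∑ N : Fin m → α, (∏ i, v (N i)) * ∑ a, (u a - v a) * Φ (Fin.cons a N) := by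
      rw [hsplit]
      simp_rw [Finset.mul_sum]
      rw [Finset.sum_comm (s := (Finset.univ : Finset (Fin m → α))), ← Finset.sum_add_distrib]
      refine Finset.sum_congr rfl fun a _ => ?_
      rw [← Finset.sum_add_distrib]
      refine Finset.sum_congr rfl fun N _ => ?_
      simp only [Fin.prod_univ_succ, Fin.cons_zero, Fin.cons_succ]
      ring
    rw [key]
    have h1 : |∑ a, u a * ∑ N : Fin m → α, ((∏ i, u (N i)) - ∏ i, v (N i)) * Φ (Fin.cons a N)| ≤
        m * η := by
      calc _ ≤ ∑ a, |u a * ∑ N : Fin m → α, ((∏ i, u (N i)) - ∏ i, v (N i)) * Φ (Fin.cons a N)| :=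
            Finset.abs_sum_le_sum_abs _ _
        _ ≤ ∑ a, u a * (m * η) := by
            refine Finset.sum_le_sum fun a _ => ?_
            rw [abs_mul, abs_of_nonneg (hu a)]
            refine mul_le_mul_of_nonneg_left (ih _ fun i N => ?_) (hu a)
            have := h i.succ (Fin.cons a N)
            simpa only [Fin.cons_update] using this
        _ = m * η := by rw [← Finset.sum_mul, hu1, one_mul]
    have h2 : |∑ N : Fin m → α, (∏ i, v (N i)) * ∑ a, (u a - v a) * Φ (Fin.cons a N)| ≤ η := by
      calc _ ≤ ∑ N : Fin m → α, |(∏ i, v (N i)) * ∑ a, (u a - v a) * Φ (Fin.cons a N)| :=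
            Finset.abs_sum_le_sum_abs _ _
        _ ≤ ∑ N : Fin m → α, (∏ i, v (N i)) * η := by
            refine Finset.sum_le_sum fun N _ => ?_
            rw [abs_mul, abs_of_nonneg (Finset.prod_nonneg fun i _ => hv _)]
            refine mul_le_mul_of_nonneg_left ?_ (Finset.prod_nonneg fun i _ => hv _)
            rcases isEmpty_or_nonempty α with hα | ⟨⟨b⟩⟩
            · simp at hu1
            · simpa using h 0 (Fin.cons b N)
        _ = η := by rw [← Finset.sum_mul, hprod, one_mul]
    calc _ ≤ _ := abs_add_le _ _
      _ ≤ m * η + η := add_le_add h1 h2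
      _ = _ := by push_cast; ring

/-! ### Averages over subsets and symmetrization. -/

theorem card_powersetCard_filter_subset {ι : Type*} [DecidableEq ι] {S F : Finset ι} (hS : S ⊆ F) {k : ℕ}
    (hk : S.card ≤ k) :
    ((F.powersetCard k).filter fun T => S ⊆ T).card = (F.card - S.card).choose (k - S.card) := by
  rw [← Finset.card_sdiff_of_subset hS, ← Finset.card_powersetCard]
  refine Finset.card_nbij' (fun T => T \ S) (fun T => T ∪ S) ?_ ?_ ?_ ?_
  · intro T hT
    simp only [Finset.coe_filter, Finset.mem_powersetCard, Set.mem_ofPred_eq, Finset.mem_coe] at hT ⊢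
    exact ⟨Finset.sdiff_subset_sdiff hT.1.1 le_rfl, by rw [Finset.card_sdiff_of_subset hT.2, hT.1.2]⟩
  · intro T hT
    simp only [Finset.coe_filter, Finset.mem_powersetCard, Set.mem_ofPred_eq, Finset.mem_coe] at hT ⊢
    refine ⟨⟨Finset.union_subset (hT.1.trans Finset.sdiff_subset) hS, ?_⟩, Finset.subset_union_right⟩
    rw [Finset.card_union_of_disjoint (Finset.disjoint_of_subset_left hT.1 Finset.sdiff_disjoint), hT.2]
    omega
  · intro T hT
    simp only [Finset.coe_filter, Set.mem_ofPred_eq] at hT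
    exact Finset.sdiff_union_of_subset hT.2
  · intro T hT
    simp only [Finset.mem_powersetCard, Finset.mem_coe] at hT
    exact Finset.union_sdiff_cancel_right (Finset.disjoint_of_subset_left hT.1 Finset.sdiff_disjoint)

/-- The average of `∏ (1 + g)` over the `k`-subsets of `F`, in terms of the averages of `∏ g` over
subsets. -/
theorem sum_powersetCard_prod_one_add {ι : Type*} [DecidableEq ι] (F : Finset ι) (g : ι → ℝ) {k K : ℕ}
    (hkK : k ≤ K) (hkF : k ≤ F.card) :
    (∑ T ∈ F.powersetCard k, ∏ i ∈ T, (1 + g i)) / (F.card.choose k : ℝ) =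
      ∑ j ∈ Finset.range (K + 1), (k.choose j : ℝ) *
        ((∑ S ∈ F.powersetCard j, ∏ i ∈ S, g i) / (F.card.choose j : ℝ)) := by
  have hpos : (0 : ℝ) < (F.card.choose k : ℝ) := by exact_mod_cast Nat.choose_pos hkF
  have h1 : ∑ T ∈ F.powersetCard k, ∏ i ∈ T, (1 + g i) =
      ∑ j ∈ Finset.range (k + 1), ∑ S ∈ F.powersetCard j,
        ((F.card - j).choose (k - j) : ℝ) * ∏ i ∈ S, g i := by
    calc _ = ∑ T ∈ F.powersetCard k, ∑ S ∈ T.powerset, ∏ i ∈ S, g i := by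
          refine Finset.sum_congr rfl fun T _ => ?_
          rw [Finset.prod_one_add]
      _ = ∑ S ∈ (Finset.range (k + 1)).biUnion (fun j => F.powersetCard j),
            ∑ T ∈ (F.powersetCard k).filter (fun T => S ⊆ T), ∏ i ∈ S, g i := by
          refine Finset.sum_comm' fun T S => ?_
          simp only [Finset.mem_powersetCard, Finset.mem_powerset, Finset.mem_filter,
            Finset.mem_biUnion, Finset.mem_range]
          constructor
          · rintro ⟨⟨hT, hc⟩, hS⟩
            have := Finset.card_le_card hS
            exact ⟨⟨⟨hT, hc⟩, hS⟩, S.card, by omega, hS.trans hT, rfl⟩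
          · rintro ⟨⟨hT, hS⟩, -⟩
            exact ⟨hT, hS⟩
      _ = _ := by
          rw [Finset.sum_biUnion]
          · refine Finset.sum_congr rfl fun j hj => Finset.sum_congr rfl fun S hS => ?_
            rw [Finset.mem_powersetCard] at hS
            rw [Finset.mem_range] at hj
            rw [Finset.sum_const, card_powersetCard_filter_subset hS.1 (by omega), hS.2, nsmul_eq_mul]
          · intro a _ b _ hab
            exact Finset.pairwise_disjoint_powersetCard F hab
  -- Terms with `j > k` vanish, so the range of `j` can be made independent of `k`.
  have h2 : ∑ j ∈ Finset.range (K + 1), (k.choose j : ℝ) *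
        ((∑ S ∈ F.powersetCard j, ∏ i ∈ S, g i) / (F.card.choose j : ℝ)) =
      ∑ j ∈ Finset.range (k + 1), (k.choose j : ℝ) *
        ((∑ S ∈ F.powersetCard j, ∏ i ∈ S, g i) / (F.card.choose j : ℝ)) := by
    refine (Finset.sum_subset (Finset.range_mono (by omega)) fun j _ hj => ?_).symm
    rw [Finset.mem_range, not_lt] at hj
    rw [Nat.choose_eq_zero_of_lt (by omega)]
    simp
  rw [h1, h2, Finset.sum_div]
  refine Finset.sum_congr rfl fun j hj => ?_
  rw [Finset.mem_range] at hj
  have hposj : (0 : ℝ) < (F.card.choose j : ℝ) := by exact_mod_cast Nat.choose_pos (by omega)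
  have h3 : (F.card.choose k : ℝ) * (k.choose j : ℝ) =
      (F.card.choose j : ℝ) * ((F.card - j).choose (k - j) : ℝ) := by
    exact_mod_cast Nat.choose_mul (n := F.card) (k := k) (s := j) (by omega)
  rw [← Finset.mul_sum]
  field_simp
  linear_combination -(∑ S ∈ F.powersetCard j, ∏ i ∈ S, g i) * h3

/-- The data set `x` with the entries at the positions in `T` replaced by `c`. -/
def replaceOn {ι X : Type*} [DecidableEq ι] (x : ι → X) (c : X) (T : Finset ι) : ι → X :=
  fun j => if j ∈ T then c else x j

theorem exists_perm_replaceOn {ι X : Type*} [Fintype ι] [DecidableEq ι] (x : ι → X) {a c : X}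
    (hac : a ≠ c) {S T : Finset ι} (hS : ∀ j ∈ S, x j = a) (hT : ∀ j ∈ T, x j = a)
    (hST : S.card = T.card) : ∃ τ : Equiv.Perm ι, replaceOn x c T ∘ τ = replaceOn x c S := by
  classical
  have hcard : ∀ (U : Finset ι), (∀ j ∈ U, x j = a) → ∀ z,
      Fintype.card {j // replaceOn x c U j = z} =
        if z = c then (Finset.univ.filter fun j => x j = c).card + U.card else
        if z = a then (Finset.univ.filter fun j => x j = a).card - U.card else
          (Finset.univ.filter fun j => x j = z).card := by
    intro U hU z
    rw [Fintype.card_subtype]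
    split_ifs with h1 h2
    · subst h1
      rw [← Finset.card_union_of_disjoint]
      · congr 1
        ext j
        simp only [replaceOn, Finset.mem_filter, Finset.mem_univ, true_and, Finset.mem_union]
        by_cases hj : j ∈ U <;> simp [hj]
      · rw [Finset.disjoint_left]
        intro j hj hjU
        rw [Finset.mem_filter] at hj
        exact hac ((hU j hjU).symm.trans hj.2)
    · subst h2
      rw [← Finset.card_sdiff_of_subset]
      · congr 1
        ext j
        simp only [Finset.mem_filter, Finset.mem_univ, true_and, Finset.mem_sdiff]
        rw [replaceOn]
        by_cases hj : j ∈ U <;> simp [hj, Ne.symm h1]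
      · intro j hj
        simp [hU j hj]
    · congr 1
      ext j
      simp only [Finset.mem_filter, Finset.mem_univ, true_and]
      rw [replaceOn]
      by_cases hj : j ∈ U
      · simp [hj, Ne.symm h1, hU j hj, Ne.symm h2]
      · simp [hj]
  -- Both data sets take every value equally often, so matching their fibres gives the permutation.
  refine ⟨Equiv.ofFiberEquiv (f := replaceOn x c S) (g := replaceOn x c T) fun z =>
    Fintype.equivOfCardEq ?_, funext fun j => Equiv.ofFiberEquiv_map _ j⟩
  rw [hcard S hS, hcard T hT, hST]

/-- After symmetrization, only the number of replaced entries matters. -/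
theorem sum_perm_replaceOn_eq {ι X : Type*} [Fintype ι] [DecidableEq ι] (Φ : (ι → X) → ℝ) (x : ι → X)
    {a c : X} (hac : a ≠ c) {F T : Finset ι} (hF : ∀ j ∈ F, x j = a) (hT : T ⊆ F) :
    ∑ σ : Equiv.Perm ι, Φ (replaceOn x c T ∘ σ) =
      ∑ σ : Equiv.Perm ι, (∑ S ∈ F.powersetCard T.card, Φ (replaceOn x c S ∘ σ)) /
        (F.card.choose T.card : ℝ) := by
  rw [← Finset.sum_div, Finset.sum_comm, eq_div_iff]
  · rw [← Finset.card_powersetCard, mul_comm, ← nsmul_eq_mul, ← Finset.sum_const]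
    refine Finset.sum_congr rfl fun S hS => ?_
    rw [Finset.mem_powersetCard] at hS
    obtain ⟨τ, hτ⟩ := exists_perm_replaceOn x hac (S := T) (T := S) (fun j hj => hF j (hT hj))
      (fun j hj => hF j (hS.1 hj)) hS.2.symm
    refine Fintype.sum_equiv (Equiv.mulLeft τ) _ _ fun σ => ?_
    rw [← hτ, Function.comp_assoc]
    rfl
  · exact_mod_cast (Nat.choose_pos (Finset.card_le_card hT)).ne'

/-! ### Product measures, likelihood ratios and orthogonality. -/

theorem lintegral_pi_prod {ι : Type*} [Fintype ι] {M : Type*} [MeasurableSpace M] (ρ : ι → Measure M)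
    [∀ i, IsProbabilityMeasure (ρ i)] {f : ι → M → ℝ≥0∞} (hf : ∀ i, Measurable (f i)) :
    ∫⁻ y, ∏ i, f i (y i) ∂Measure.pi ρ = ∏ i, ∫⁻ m, f i m ∂ρ i := by
  have h := lintegral_prod_eq_prod_lintegral_of_indepFun (μ := Measure.pi ρ) Finset.univ
    (fun i (y : ι → M) => f i (y i))
    ((iIndepFun_pi (μ := ρ) (X := fun i m => m) fun i => aemeasurable_id).comp f hf)
    (fun i => (hf i).comp (measurable_pi_apply i))
  refine h.trans (Finset.prod_congr rfl fun i _ => ?_)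
  exact (measurePreserving_eval ρ i).lintegral_comp (hf i)

theorem pi_withDensity {ι : Type*} [Fintype ι] {M : Type*} [MeasurableSpace M] (ρ : ι → Measure M)
    [∀ i, IsProbabilityMeasure (ρ i)] {f : ι → M → ℝ≥0∞} (hf : ∀ i, Measurable (f i))
    [∀ i, SigmaFinite ((ρ i).withDensity (f i))] :
    Measure.pi (fun i => (ρ i).withDensity (f i)) =
      (Measure.pi ρ).withDensity fun y => ∏ i, f i (y i) := by
  refine Measure.pi_eq fun s hs => ?_
  rw [withDensity_apply _ (MeasurableSet.univ_pi hs), ← lintegral_indicator (MeasurableSet.univ_pi hs)]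
  simp_rw [withDensity_apply _ (hs _), ← lintegral_indicator (hs _)]
  rw [← lintegral_pi_prod ρ fun i => (hf i).indicator (hs i)]
  refine lintegral_congr fun y => ?_
  by_cases hy : y ∈ Set.univ.pi s
  · rw [Set.indicator_of_mem hy]
    exact Finset.prod_congr rfl fun i _ => (Set.indicator_of_mem (hy i (Set.mem_univ i)) _).symm
  · rw [Set.indicator_of_notMem hy]
    simp only [Set.mem_pi, Set.mem_univ, true_imp_iff, not_forall] at hy
    obtain ⟨i, hi⟩ := hy
    exact (Finset.prod_eq_zero (Finset.mem_univ i) (Set.indicator_of_notMem hi _)).symm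

/-- `OuterMeasure.pi` is the largest outer measure dominated by the product on boxes, so a
comparison on boxes suffices. -/
theorem pi_mono_measure {ι : Type*} [Fintype ι] {M : Type*} [MeasurableSpace M] {μ ν : ι → Measure M}
    [∀ i, SigmaFinite (μ i)] [∀ i, SigmaFinite (ν i)] (h : ∀ i, μ i ≤ ν i) :
    Measure.pi μ ≤ Measure.pi ν := by
  have h1 : (Measure.pi μ).toOuterMeasure ≤ OuterMeasure.pi fun i => (ν i).toOuterMeasure := by
    rw [OuterMeasure.le_pi]
    intro s _
    rw [Measure.coe_toOuterMeasure, Measure.pi_pi]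
    exact Finset.prod_le_prod' fun i _ => h i _
  rw [Measure.le_iff]
  intro s hs
  have h2 : Measure.pi ν s = (OuterMeasure.pi fun i => (ν i).toOuterMeasure) s := by
    rw [Measure.pi, toMeasure_apply _ _ hs]
  rw [h2]
  exact h1 s

theorem integral_pi_replaceOn_withDensity {ι : Type*} [Fintype ι] [DecidableEq ι] {M : Type*}
    [MeasurableSpace M] (ρ : ι → Measure M) [∀ i, IsProbabilityMeasure (ρ i)] {P Q : Measure M}
    [IsProbabilityMeasure Q] {f : M → ℝ} (hf : Measurable f) (hf0 : ∀ m, 0 ≤ f m)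
    (hQ : Q = P.withDensity fun m => ENNReal.ofReal (f m)) {T : Finset ι} (hT : ∀ j ∈ T, ρ j = P)
    (φ : (ι → M) → ℝ) :
    ∫ y, φ y ∂Measure.pi (replaceOn ρ Q T) = ∫ y, φ y * ∏ j ∈ T, f (y j) ∂Measure.pi ρ := by
  have h1 : replaceOn ρ Q T = fun i => (ρ i).withDensity
      (fun m => if i ∈ T then ENNReal.ofReal (f m) else 1) := by
    funext i
    by_cases hi : i ∈ T
    · simp [replaceOn, hi, hQ, hT i hi]
    · simp only [replaceOn, hi, if_false]
      exact withDensity_one.symm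
  have h2 : ∀ i, SigmaFinite ((ρ i).withDensity
      (fun m => if i ∈ T then ENNReal.ofReal (f m) else 1)) := by
    intro i
    rw [← congrFun h1 i]
    by_cases hi : i ∈ T
    · simp only [replaceOn, hi, if_true]; infer_instance
    · simp only [replaceOn, hi, if_false]; infer_instance
  have hm : ∀ i, Measurable (fun m => if i ∈ T then ENNReal.ofReal (f m) else 1) := by
    intro i
    by_cases hi : i ∈ T
    · simp only [hi, if_true]; fun_prop
    · simp only [hi, if_false]; fun_prop
  have h3 : (fun y : ι → M => ∏ i, (if i ∈ T then ENNReal.ofReal (f (y i)) else 1)) =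
      fun y => ENNReal.ofReal (∏ j ∈ T, f (y j)) := by
    funext y
    rw [ENNReal.ofReal_prod_of_nonneg fun i _ => hf0 _, Finset.prod_ite_mem, Finset.univ_inter]
  rw [h1, pi_withDensity ρ hm, h3, integral_withDensity_eq_integral_toReal_smul]
  · refine integral_congr_ae (Eventually.of_forall fun y => ?_)
    simp only [smul_eq_mul]
    rw [ENNReal.toReal_ofReal (Finset.prod_nonneg fun i _ => hf0 _), mul_comm]
  · have : Measurable fun y : ι → M => ∏ j ∈ T, f (y j) := by fun_prop
    exact this.ennreal_ofReal
  · exact Eventually.of_forall fun y => ENNReal.ofReal_lt_top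

/-- Products over different subsets of coordinates of a centred function are orthogonal. -/
theorem integral_prod_mul_prod {ι : Type*} [Fintype ι] [DecidableEq ι] {M : Type*}
    [MeasurableSpace M] (ρ : ι → Measure M) [∀ i, IsProbabilityMeasure (ρ i)] {P : Measure M}
    {g : M → ℝ} (hg : ∫ m, g m ∂P = 0) {F S T : Finset ι} (hF : ∀ j ∈ F, ρ j = P) (hS : S ⊆ F)
    (hT : T ⊆ F) :
    ∫ y, (∏ j ∈ S, g (y j)) * ∏ j ∈ T, g (y j) ∂Measure.pi ρ =
      if S = T then (∫ m, g m ^ 2 ∂P) ^ S.card else 0 := by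
  have h1 : ∀ y : ι → M, (∏ j ∈ S, g (y j)) * ∏ j ∈ T, g (y j) =
      ∏ j, (if j ∈ S then g (y j) else 1) * (if j ∈ T then g (y j) else 1) := by
    intro y
    rw [Finset.prod_mul_distrib, Finset.prod_ite_mem, Finset.prod_ite_mem, Finset.univ_inter,
      Finset.univ_inter]
  simp_rw [h1]
  rw [integral_fintype_prod_eq_prod (μ := ρ)
    (fun j m => (if j ∈ S then g m else 1) * (if j ∈ T then g m else 1))]
  split_ifs with h
  · subst h
    rw [← Finset.prod_const, ← Finset.univ_inter S, ← Finset.prod_ite_mem]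
    refine Finset.prod_congr rfl fun j _ => ?_
    by_cases hj : j ∈ S
    · simp [hj, hF j (hS hj), sq]
    · simp [hj]
  -- A coordinate lying in exactly one of the two sets contributes the factor `∫ g = 0`.
  · have : ∃ j, ¬ (j ∈ S ↔ j ∈ T) := by
      by_contra hc
      push Not at hc
      exact h (Finset.ext hc)
    obtain ⟨j, hj⟩ := this
    refine Finset.prod_eq_zero (Finset.mem_univ j) ?_
    by_cases hjS : j ∈ S
    · have hjT : j ∉ T := by tauto
      simp [hjS, hjT, hF j (hS hjS), hg]
    · have hjT : j ∈ T := by tauto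
      simp [hjS, hjT, hF j (hT hjT), hg]

/-- Cauchy–Schwarz, from `2t|h| ≤ t² + h²` with `t = √B`. If `B = 0`, taking `t` to be the
supposedly positive left side gives a contradiction. -/
theorem abs_integral_mul_le_sqrt {Ω : Type*} [MeasurableSpace Ω] (μ : Measure Ω)
    [IsProbabilityMeasure μ] {φ h : Ω → ℝ} (hφ : ∀ y, |φ y| ≤ 1)
    (hh : Integrable (fun y => h y ^ 2) μ) (hφh : Integrable (fun y => φ y * h y) μ) {B : ℝ}
    (hB : ∫ y, h y ^ 2 ∂μ ≤ B) : |∫ y, φ y * h y ∂μ| ≤ Real.sqrt B := by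
  have hB0 : 0 ≤ B := (integral_nonneg fun y => sq_nonneg (h y)).trans hB
  have key : ∀ t : ℝ, 0 < t → 2 * t * |∫ y, φ y * h y ∂μ| ≤ t ^ 2 + B := by
    intro t ht
    have h1 : |∫ y, φ y * h y ∂μ| ≤ ∫ y, |φ y * h y| ∂μ := abs_integral_le_integral_abs
    have h2 : ∫ y, 2 * t * |φ y * h y| ∂μ ≤ ∫ y, (t ^ 2 + h y ^ 2) ∂μ := by
      refine integral_mono (hφh.abs.const_mul _) ((integrable_const _).add hh) fun y => ?_
      have h3 : |φ y * h y| ≤ |h y| := by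
        rw [abs_mul]
        exact mul_le_of_le_one_left (abs_nonneg _) (hφ y)
      have h4 : h y ^ 2 = |h y| ^ 2 := (sq_abs _).symm
      simp only
      rw [h4]
      nlinarith [sq_nonneg (t - |h y|)]
    rw [integral_const_mul, integral_add (integrable_const _) hh] at h2
    simp only [integral_const, probReal_univ, one_smul] at h2
    nlinarith
  rcases hB0.eq_or_lt with h0 | hpos
  · rw [← h0, Real.sqrt_zero]
    by_contra hc
    push Not at hc
    have := key _ hc
    nlinarith
  · have hs : 0 < Real.sqrt B := Real.sqrt_pos.2 hpos
    have := key _ hs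
    rw [Real.sq_sqrt hB0] at this
    have h5 := Real.mul_self_sqrt hB0
    nlinarith

/-- Write each likelihood ratio as `1 + g` with `g` centred. The averaged product becomes `∑ j,
k.choose j * h j`, where `h j` is the mean of `∏ g` over `j`-subsets. By orthogonality its second
moment is `(∫ g²)^j / F.card.choose j`. Summing over `k` first leaves the binomial moments of `w`,
and Cauchy–Schwarz bounds the correlation of `h j` with `φ`. -/
theorem abs_sum_mul_average_le {ι : Type*} [Fintype ι] [DecidableEq ι] {M : Type*}
    [MeasurableSpace M] (ρ : ι → Measure M) [∀ i, IsProbabilityMeasure (ρ i)] {P Q : Measure M}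
    [IsProbabilityMeasure P] [IsProbabilityMeasure Q] {f : M → ℝ} (hf : Measurable f)
    (hf0 : ∀ m, 0 ≤ f m) {C : ℝ} (hfC : ∀ m, f m ≤ C)
    (hQ : Q = P.withDensity fun m => ENNReal.ofReal (f m)) {F : Finset ι} (hF : ∀ j ∈ F, ρ j = P)
    {φ : (ι → M) → ℝ} (hφ : Measurable φ) (hφ1 : ∀ y, |φ y| ≤ 1) (w : ℕ → ℝ) {K : ℕ}
    (hK : K ≤ F.card) :
    |∑ k ∈ Finset.range (K + 1), w k * ((∑ T ∈ F.powersetCard k,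
        ∫ y, φ y ∂Measure.pi (replaceOn ρ Q T)) / (F.card.choose k : ℝ))| ≤
      ∑ j ∈ Finset.range (K + 1), |∑ k ∈ Finset.range (K + 1), w k * (k.choose j : ℝ)| *
        Real.sqrt (C ^ j / (F.card.choose j : ℝ)) := by
  set Λ := Measure.pi ρ with hΛ
  set g : M → ℝ := fun m => f m - 1 with hg
  have hgm : Measurable g := by fun_prop
  have hgb : ∀ m, |g m| ≤ C + 1 := fun m => abs_le.2
    ⟨by simp only [hg]; linarith [hf0 m, hfC m], by simp only [hg]; linarith [hf0 m, hfC m]⟩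
  have hfi : Integrable f P := Integrable.of_bound hf.aestronglyMeasurable C
    (Eventually.of_forall fun m => by rw [Real.norm_of_nonneg (hf0 m)]; exact hfC m)
  have hf1 : ∫ m, f m ∂P = 1 := by
    have h := measure_univ (μ := Q)
    rw [hQ, withDensity_apply _ MeasurableSet.univ, Measure.restrict_univ,
      ← ofReal_integral_eq_lintegral_ofReal hfi (Eventually.of_forall hf0),
      ENNReal.ofReal_eq_one] at h
    exact h
  have hg0 : ∫ m, g m ∂P = 0 := by
    simp only [hg]
    rw [integral_sub hfi (integrable_const _), hf1]
    simp
  -- Since `f² ≤ C f` pointwise, `(f - 1)² ≤ (C - 2) f + 1`, whose integral is `C - 1`. The bound is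
  -- linear in `C`, hence in `e^ε`.
  have hg2 : ∫ m, g m ^ 2 ∂P ≤ C := by
    have hle : ∫ m, g m ^ 2 ∂P ≤ ∫ m, ((C - 2) * f m + 1) ∂P := by
      refine integral_mono ?_ ((hfi.const_mul _).add (integrable_const _)) fun m => ?_
      · refine Integrable.of_bound (by fun_prop) ((C + 1) ^ 2) (Eventually.of_forall fun m => ?_)
        rw [norm_pow]
        exact pow_le_pow_left₀ (norm_nonneg _) (hgb m) 2
      · simp only [hg]
        nlinarith [hf0 m, hfC m]
    rw [integral_add (hfi.const_mul _) (integrable_const _), integral_const_mul, hf1] at hle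
    simp only [integral_const, probReal_univ, one_smul] at hle
    linarith
  have heb : ∀ (S : Finset ι) (y : ι → M), |∏ j ∈ S, g (y j)| ≤ (C + 1) ^ S.card := by
    intro S y
    rw [Finset.abs_prod, ← Finset.prod_const]
    exact Finset.prod_le_prod (fun _ _ => abs_nonneg _) fun _ _ => hgb _
  have hφe : ∀ S : Finset ι, Integrable (fun y => φ y * ∏ j ∈ S, g (y j)) Λ := by
    intro S
    refine Integrable.of_bound (by fun_prop) ((C + 1) ^ S.card) (Eventually.of_forall fun y => ?_)
    rw [Real.norm_eq_abs, abs_mul]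
    exact (mul_le_of_le_one_left (abs_nonneg _) (hφ1 y)).trans (heb S y)
  have hee : ∀ S T : Finset ι, Integrable (fun y => (∏ j ∈ S, g (y j)) * ∏ j ∈ T, g (y j)) Λ := by
    intro S T
    refine Integrable.of_bound (by fun_prop) ((C + 1) ^ S.card * (C + 1) ^ T.card)
      (Eventually.of_forall fun y => ?_)
    rw [Real.norm_eq_abs, abs_mul]
    exact mul_le_mul (heb S y) (heb T y) (abs_nonneg _) ((abs_nonneg _).trans (heb S y))
  set h : ℕ → (ι → M) → ℝ := fun j y =>
    (∑ S ∈ F.powersetCard j, ∏ i ∈ S, g (y i)) / (F.card.choose j : ℝ) with hh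
  have hφh : ∀ j, Integrable (fun y => φ y * h j y) Λ := by
    intro j
    have : (fun y => φ y * h j y) = fun y =>
        (∑ S ∈ F.powersetCard j, φ y * ∏ i ∈ S, g (y i)) / (F.card.choose j : ℝ) := by
      funext y
      simp only [hh]
      rw [← mul_div_assoc, Finset.mul_sum]
    rw [this]
    exact (integrable_finsetSum _ fun S _ => hφe S).div_const _
  have hsq : ∀ j, (fun y => h j y ^ 2) = fun y => (∑ S ∈ F.powersetCard j, ∑ T ∈ F.powersetCard j,
      (∏ i ∈ S, g (y i)) * ∏ i ∈ T, g (y i)) / (F.card.choose j : ℝ) ^ 2 := by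
    intro j
    funext y
    simp only [hh]
    rw [div_pow, sq (Finset.sum _ _), Finset.sum_mul_sum]
  have hh2 : ∀ j, Integrable (fun y => h j y ^ 2) Λ := by
    intro j
    rw [hsq]
    exact (integrable_finsetSum _ fun S _ => integrable_finsetSum _ fun T _ => hee S T).div_const _
  have hvar : ∀ j ≤ K, ∫ y, h j y ^ 2 ∂Λ ≤ C ^ j / (F.card.choose j : ℝ) := by
    intro j hj
    have hpos : (0 : ℝ) < (F.card.choose j : ℝ) := by
      exact_mod_cast Nat.choose_pos (hj.trans hK)
    have h1 : ∫ y, h j y ^ 2 ∂Λ = (∑ S ∈ F.powersetCard j, (∫ m, g m ^ 2 ∂P) ^ j) /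
        (F.card.choose j : ℝ) ^ 2 := by
      rw [hsq, integral_div, integral_finsetSum _ fun S _ => integrable_finsetSum _ fun T _ => hee S T]
      congr 1
      refine Finset.sum_congr rfl fun S hS => ?_
      rw [integral_finsetSum _ fun T _ => hee S T, ← (Finset.mem_powersetCard.1 hS).2]
      rw [Finset.sum_congr rfl fun T hT => integral_prod_mul_prod ρ hg0 hF
        (Finset.mem_powersetCard.1 hS).1 (Finset.mem_powersetCard.1 hT).1]
      rw [Finset.sum_ite_eq, if_pos]
      exact Finset.mem_powersetCard.2 ⟨(Finset.mem_powersetCard.1 hS).1, rfl⟩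
    rw [h1, Finset.sum_const, Finset.card_powersetCard, nsmul_eq_mul, div_le_div_iff₀ (by positivity) hpos]
    have h2 : (∫ m, g m ^ 2 ∂P) ^ j ≤ C ^ j :=
      pow_le_pow_left₀ (integral_nonneg fun m => sq_nonneg _) hg2 j
    nlinarith [mul_le_mul_of_nonneg_left h2 (sq_nonneg (F.card.choose j : ℝ))]
  have hA : ∀ k ∈ Finset.range (K + 1), (∑ T ∈ F.powersetCard k,
        ∫ y, φ y ∂Measure.pi (replaceOn ρ Q T)) / (F.card.choose k : ℝ) =
      ∑ j ∈ Finset.range (K + 1), (k.choose j : ℝ) * ∫ y, φ y * h j y ∂Λ := by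
    intro k hk
    rw [Finset.mem_range] at hk
    have hfe : ∀ T : Finset ι, Integrable (fun y => φ y * ∏ j ∈ T, f (y j)) Λ := by
      intro T
      refine Integrable.of_bound (by fun_prop) (C ^ T.card) (Eventually.of_forall fun y => ?_)
      rw [Real.norm_eq_abs, abs_mul]
      refine (mul_le_of_le_one_left (abs_nonneg _) (hφ1 y)).trans ?_
      rw [Finset.abs_prod, ← Finset.prod_const]
      exact Finset.prod_le_prod (fun _ _ => abs_nonneg _) fun j _ => by
        rw [abs_of_nonneg (hf0 _)]; exact hfC _
    calc _ = (∑ T ∈ F.powersetCard k, ∫ y, φ y * ∏ j ∈ T, f (y j) ∂Λ) / (F.card.choose k : ℝ) := by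
          congr 1
          refine Finset.sum_congr rfl fun T hT => ?_
          exact integral_pi_replaceOn_withDensity ρ hf hf0 hQ
            (fun j hj => hF j ((Finset.mem_powersetCard.1 hT).1 hj)) φ
      _ = ∫ y, ∑ j ∈ Finset.range (K + 1), (k.choose j : ℝ) * (φ y * h j y) ∂Λ := by
          rw [← integral_finsetSum _ fun T _ => hfe T, ← integral_div]
          refine integral_congr_ae (Eventually.of_forall fun y => ?_)
          have h1 := sum_powersetCard_prod_one_add F (fun i => g (y i)) (k := k) (K := K)
            (by omega) (by omega)
          simp only [hg, add_sub_cancel] at h1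
          simp only
          rw [← Finset.mul_sum, mul_div_assoc, h1, Finset.mul_sum]
          refine Finset.sum_congr rfl fun j _ => ?_
          simp only [hh, hg]
          ring
      _ = _ := by
          rw [integral_finsetSum _ fun j _ => (hφh j).const_mul _]
          exact Finset.sum_congr rfl fun j _ => integral_const_mul _ _
  rw [Finset.sum_congr rfl fun k hk => by rw [hA k hk, Finset.mul_sum], Finset.sum_comm]
  refine (Finset.abs_sum_le_sum_abs _ _).trans (Finset.sum_le_sum fun j hj => ?_)
  rw [Finset.mem_range] at hj
  rw [Finset.sum_congr rfl fun k _ => (mul_assoc (w k) (k.choose j : ℝ) _).symm, ← Finset.sum_mul, abs_mul]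
  exact mul_le_mul_of_nonneg_left
    (abs_integral_mul_le_sqrt Λ hφ1 (hh2 j) (hφh j) (hvar j (by omega))) (abs_nonneg _)

/-! ### From approximate privacy to bounded densities. -/

open scoped NNReal in
/-- Outside an event on which `Q` exceeds `c • P`, the measure `Q` is below a probability measure
with a density bounded by `c + 1` with respect to `P`. -/
theorem exists_bounded_density_truncation {M : Type*} [MeasurableSpace M] (P Q : Measure M)
    [IsProbabilityMeasure P] [IsProbabilityMeasure Q] (c : ℝ≥0) :
    ∃ (s : Set M) (f : M → ℝ), MeasurableSet s ∧ Measurable f ∧ (∀ m, 0 ≤ f m) ∧ (∀ m, f m ≤ c + 1) ∧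
      IsProbabilityMeasure (P.withDensity fun m => ENNReal.ofReal (f m)) ∧
      Q.restrict s ≤ P.withDensity (fun m => ENNReal.ofReal (f m)) ∧ c * P sᶜ ≤ Q sᶜ := by
  obtain ⟨s, hs, hle, hge⟩ := hahn_decomposition (c • P) Q
  have hQs : ∀ t, MeasurableSet t → Q.restrict s t ≤ c * P t := by
    intro t ht
    rw [Measure.restrict_apply ht]
    calc _ ≤ (c • P) (t ∩ s) := hle _ (ht.inter hs) Set.inter_subset_right
      _ = c * P (t ∩ s) := rfl
      _ ≤ _ := by gcongr; exact Set.inter_subset_left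
  have hac : Q.restrict s ≪ P := by
    refine Measure.AbsolutelyContinuous.mk fun t ht h0 => ?_
    have := hQs t ht
    rw [h0, mul_zero] at this
    exact le_antisymm this bot_le
  set f₀ := (Q.restrict s).rnDeriv P with hf₀
  have hf₀m : Measurable f₀ := Measure.measurable_rnDeriv _ _
  have hwd : P.withDensity f₀ = Q.restrict s := Measure.withDensity_rnDeriv_eq _ _ hac
  have hf₀c : f₀ ≤ᵐ[P] fun _ => (c : ℝ≥0∞) := by
    refine ae_le_of_forall_setLIntegral_le_of_sigmaFinite hf₀m fun t ht _ => ?_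
    rw [← withDensity_apply _ ht, hwd, setLIntegral_const]
    exact hQs t ht
  -- The mass lost on `sᶜ` is returned as a multiple of `P`, adding at most `1` to the density. The
  -- minimum turns the almost everywhere bound into a pointwise one.
  set f₁ : M → ℝ≥0∞ := fun m => min (f₀ m) c + Q sᶜ with hf₁
  have hf₁m : Measurable f₁ := (hf₀m.min measurable_const).add measurable_const
  have hf₁c : ∀ m, f₁ m ≤ c + 1 := fun m => add_le_add (min_le_right _ _) prob_le_one
  have hf₁t : ∀ m, f₁ m ≠ ∞ := fun m => ne_top_of_le_ne_top (by finiteness) (hf₁c m)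
  have hof : (fun m => ENNReal.ofReal (f₁ m).toReal) = f₁ :=
    funext fun m => ENNReal.ofReal_toReal (hf₁t m)
  have hwd₁ : P.withDensity f₁ = Q.restrict s + Q sᶜ • P := by
    have h1 : P.withDensity (fun m => min (f₀ m) c) = Q.restrict s := by
      rw [← hwd]
      refine withDensity_congr_ae ?_
      filter_upwards [hf₀c] with m hm
      exact min_eq_left hm
    have h2 : f₁ = (fun m => min (f₀ m) c) + fun _ => Q sᶜ := rfl
    rw [h2, withDensity_add_left (hf₀m.min measurable_const), h1, withDensity_const]
  refine ⟨s, fun m => (f₁ m).toReal, hs, hf₁m.ennreal_toReal, fun m => ENNReal.toReal_nonneg,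
    fun m => ?_, ?_, ?_, ?_⟩
  · have := ENNReal.toReal_mono (by finiteness) (hf₁c m)
    simpa [ENNReal.toReal_add] using this
  · rw [hof, hwd₁]
    refine ⟨?_⟩
    rw [Measure.add_apply, Measure.restrict_apply_univ, Measure.smul_apply, measure_univ, smul_eq_mul,
      mul_one, measure_add_measure_compl hs, measure_univ]
  · rw [hof, hwd₁]
    exact Measure.le_add_right le_rfl
  · exact hge _ hs.compl subset_rfl

/-- On the box where every coordinate lies in its good set the product measures are comparable; a
union bound pays for the complement. -/
theorem lintegral_pi_le_add_sum {ι : Type*} [Fintype ι] {M : Type*} [MeasurableSpace M]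
    (μ ν : ι → Measure M) [∀ i, IsProbabilityMeasure (μ i)] [∀ i, IsProbabilityMeasure (ν i)]
    {s : ι → Set M} (hs : ∀ i, MeasurableSet (s i)) (h : ∀ i, (μ i).restrict (s i) ≤ ν i)
    {φ : (ι → M) → ℝ≥0∞} (hφ : ∀ y, φ y ≤ 1) :
    ∫⁻ y, φ y ∂Measure.pi μ ≤ ∫⁻ y, φ y ∂Measure.pi ν + ∑ i, μ i (s i)ᶜ := by
  have hG : MeasurableSet (Set.univ.pi s) := MeasurableSet.univ_pi hs
  rw [← lintegral_add_compl φ hG]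
  refine add_le_add ?_ ?_
  · rw [Measure.restrict_pi_pi]
    exact lintegral_mono' (pi_mono_measure h) le_rfl
  · calc ∫⁻ y in (Set.univ.pi s)ᶜ, φ y ∂Measure.pi μ ≤ ∫⁻ y in (Set.univ.pi s)ᶜ, 1 ∂Measure.pi μ :=
          lintegral_mono fun y => hφ y
      _ = Measure.pi μ (Set.univ.pi s)ᶜ := by rw [setLIntegral_const, one_mul]
      _ ≤ Measure.pi μ (⋃ i, (fun y : ι → M => y i) ⁻¹' (s i)ᶜ) := by
          refine measure_mono fun y hy => ?_
          simp only [Set.mem_compl_iff, Set.mem_pi, Set.mem_univ, true_imp_iff, not_forall] at hy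
          obtain ⟨i, hi⟩ := hy
          exact Set.mem_iUnion.2 ⟨i, hi⟩
      _ ≤ ∑ i, Measure.pi μ ((fun y : ι → M => y i) ⁻¹' (s i)ᶜ) := measure_iUnion_fintype_le _ _
      _ = ∑ i, μ i (s i)ᶜ := Finset.sum_congr rfl fun i _ =>
          (measurePreserving_eval μ i).measure_preimage (hs i).compl.nullMeasurableSet

namespace PublicCoinLocalProtocol

variable {n : ℕ} {X : Type} {M : Type u} [MeasurableSpace M]

theorem output_apply (P : PublicCoinLocalProtocol n X M) (x : Fin n → X) {E : Set ℝ}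
    (hE : MeasurableSet E) :
    P.output x E = ∑' a, P.pub a * ∫⁻ y, P.A a y E ∂Measure.pi fun i => (P.R a (x i) : Measure M) := by
  rw [output, Measure.sum_apply _ hE]
  refine tsum_congr fun a => ?_
  rw [Measure.smul_apply, Measure.bind_apply hE (P.A a).aemeasurable, smul_eq_mul]

/-- A locally private protocol may be replaced by one whose randomizers have bounded densities with
respect to the randomizer of a fixed input, at the cost of `2 n δ` in total variation. -/
theorem IsLocallyDP.exists_dominated {P : PublicCoinLocalProtocol n X M} {ε δ : ℝ}
    (hP : P.IsLocallyDP ε δ) (z : X) :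
    ∃ R : List Bool → X → Measure M, (∀ a i, IsProbabilityMeasure (R a i)) ∧
      (∀ a i, i ≠ z → ∃ f : M → ℝ, Measurable f ∧ (∀ m, 0 ≤ f m) ∧ (∀ m, f m ≤ 2 * Real.exp ε + 1) ∧
        R a i = (R a z).withDensity fun m => ENNReal.ofReal (f m)) ∧
      ∀ (x : Fin n → X) (E : Set ℝ), MeasurableSet E →
        P.output x E ≤ ∑' a, P.pub a * ∫⁻ y, P.A a y E ∂Measure.pi (fun i => R a (x i)) +
          ENNReal.ofReal (2 * n * δ) := by
  classical
  -- Twice the privacy factor: on the bad event, of probability `T`, privacy then gives `T ≤ T / 2 +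
  -- δ`, so `T ≤ 2δ`.
  set c : NNReal := (2 * Real.exp ε).toNNReal
  have hcE : (c : ℝ≥0∞) = 2 * ENNReal.ofReal (Real.exp ε) := by
    change ENNReal.ofReal (2 * Real.exp ε) = _
    rw [ENNReal.ofReal_mul zero_le_two, ENNReal.ofReal_ofNat]
  have hcR : (c : ℝ) = 2 * Real.exp ε := Real.coe_toNNReal _ (by positivity)
  choose s f hs hf hf0 hfc hprob hle hge using fun (a : List Bool) (i : X) =>
    exists_bounded_density_truncation (P.R a z : Measure M) (P.R a i : Measure M) c
  set R : List Bool → X → Measure M := fun a i =>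
    if i = z then (P.R a z : Measure M) else
      (P.R a z : Measure M).withDensity fun m => ENNReal.ofReal (f a i m) with hR
  have hRp : ∀ a i, IsProbabilityMeasure (R a i) := by
    intro a i
    simp only [hR]
    split_ifs
    · infer_instance
    · exact hprob a i
  set s' : List Bool → X → Set M := fun a i => if i = z then Set.univ else s a i with hs'
  have hsm : ∀ a i, MeasurableSet (s' a i) := by
    intro a i
    simp only [hs']
    split_ifs
    · exact MeasurableSet.univ
    · exact hs a i
  have hrle : ∀ a i, (P.R a i : Measure M).restrict (s' a i) ≤ R a i := by
    intro a i
    simp only [hs', hR]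
    split_ifs with h
    · rw [h, Measure.restrict_univ]
    · exact hle a i
  -- Privacy holds for the pair of coins and message, so the bad events are controlled only on
  -- average over the coins.
  have htail : ∀ i, ∑' a, P.pub a * (P.R a i : Measure M) (s' a i)ᶜ ≤ ENNReal.ofReal (2 * δ) := by
    intro i
    by_cases h : i = z
    · simp [hs', h]
    simp only [hs', h, if_false]
    have h1 := hP i z (fun a => (s a i)ᶜ) fun a => (hs a i).compl
    set T := P.viewProb i fun a => (s a i)ᶜ with hT
    have h2 : 2 * ENNReal.ofReal (Real.exp ε) * P.viewProb z (fun a => (s a i)ᶜ) ≤ T := by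
      rw [hT, viewProb, viewProb, ← ENNReal.tsum_mul_left]
      refine ENNReal.tsum_le_tsum fun a => ?_
      rw [mul_left_comm, ← hcE]
      gcongr
      exact hge a i
    have hT1 : T ≤ 1 := by
      rw [← P.pub.tsum_coe]
      exact ENNReal.tsum_le_tsum fun a => mul_le_of_le_one_right bot_le prob_le_one
    have h3 : T + T ≤ T + ENNReal.ofReal (2 * δ) := by
      calc T + T = 2 * T := (two_mul T).symm
        _ ≤ 2 * (ENNReal.ofReal (Real.exp ε) * P.viewProb z (fun a => (s a i)ᶜ) + ENNReal.ofReal δ) := by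
            gcongr
        _ = 2 * ENNReal.ofReal (Real.exp ε) * P.viewProb z (fun a => (s a i)ᶜ) +
            ENNReal.ofReal (2 * δ) := by
            rw [mul_add, mul_assoc, ENNReal.ofReal_mul zero_le_two, ENNReal.ofReal_ofNat]
        _ ≤ _ := by gcongr
    exact (ENNReal.add_le_add_iff_left (ne_top_of_le_ne_top ENNReal.one_ne_top hT1)).1 h3
  refine ⟨R, hRp, fun a i hi => ⟨f a i, hf a i, hf0 a i, fun m => hcR ▸ hfc a i m, by simp [hR, hi]⟩, fun x E hE => ?_⟩
  rw [output_apply _ _ hE]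
  calc _ ≤ ∑' a, (P.pub a * ∫⁻ y, P.A a y E ∂Measure.pi (fun i => R a (x i)) +
        ∑ i, P.pub a * (P.R a (x i) : Measure M) (s' a (x i))ᶜ) := by
        refine ENNReal.tsum_le_tsum fun a => ?_
        rw [← Finset.mul_sum, ← mul_add]
        gcongr
        have := P.markov a
        exact lintegral_pi_le_add_sum _ _ (fun i => hsm a (x i)) (fun i => hrle a (x i))
          fun y => prob_le_one
    _ = ∑' a, P.pub a * ∫⁻ y, P.A a y E ∂Measure.pi (fun i => R a (x i)) +
        ∑ i, ∑' a, P.pub a * (P.R a (x i) : Measure M) (s' a (x i))ᶜ := by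
        rw [ENNReal.tsum_add, Summable.tsum_finsetSum fun _ _ => ENNReal.summable]
    _ ≤ _ := by
        gcongr
        refine (Finset.sum_le_sum fun i _ => htail (x i)).trans_eq ?_
        rw [Finset.sum_const, Finset.card_univ, Fintype.card_fin, nsmul_eq_mul,
          ← ENNReal.ofReal_natCast, ← ENNReal.ofReal_mul (Nat.cast_nonneg n)]
        congr 1
        ring

end PublicCoinLocalProtocol

/-! ### The hard data sets. -/

/-- The data set with `N i` copies of `i + 1` for every `i`, placed in blocks of length `K`, and
copies of `0` elsewhere. -/
def blockDataset (n K : ℕ) {D : ℕ} (N : Fin D → Fin (K + 1)) : Fin n → Fin (D + 1) := fun j =>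
  if h : (j : ℕ) / K < D then
    if (j : ℕ) % K < N ⟨(j : ℕ) / K, h⟩ then Fin.succ ⟨(j : ℕ) / K, h⟩ else 0
  else 0

/-- The first `k` positions of the `i`-th block of length `K`. -/
def blockPositions (n K i k : ℕ) : Finset (Fin n) :=
  Finset.univ.filter fun j => (j : ℕ) / K = i ∧ (j : ℕ) % K < k

theorem card_blockPositions {n K D : ℕ} (hn : D * K ≤ n) (i : Fin D) {k : ℕ} (hk : k ≤ K) :
    (blockPositions n K i k).card = k := by
  have hb : ∀ r < K, i * K + r < n := by
    intro r hr
    have : (i + 1) * K ≤ D * K := Nat.mul_le_mul_right _ i.2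
    rw [add_mul, one_mul] at this
    omega
  have : (blockPositions n K i k).map Fin.valEmbedding =
      (Finset.range k).map (addLeftEmbedding (i * K)) := by
    ext j
    simp only [blockPositions, Finset.mem_map, Finset.mem_filter, Finset.mem_univ, true_and,
      Fin.valEmbedding_apply, Finset.mem_range, addLeftEmbedding_apply]
    constructor
    · rintro ⟨a, ⟨h1, h2⟩, rfl⟩
      exact ⟨a % K, h2, by rw [← h1]; exact Nat.div_add_mod' a K⟩
    · rintro ⟨r, hr, rfl⟩
      refine ⟨⟨i * K + r, hb r (by omega)⟩, ⟨?_, ?_⟩, rfl⟩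
      · simp only
        rw [mul_comm, Nat.mul_add_div (by omega), Nat.div_eq_of_lt (by omega), add_zero]
      · simp only
        rw [mul_comm, Nat.mul_add_mod, Nat.mod_eq_of_lt (by omega)]
        exact hr
  rw [← Finset.card_map Fin.valEmbedding, this, Finset.card_map, Finset.card_range]

/-- Changing one multiplicity is a replacement inside the zeros of a fixed data set, the setting of
the symmetrization lemma. -/
theorem blockDataset_update {n K D : ℕ} (N : Fin D → Fin (K + 1)) (i : Fin D) (a : Fin (K + 1)) :
    blockDataset n K (Function.update N i a) =
      replaceOn (blockDataset n K (Function.update N i 0)) i.succ (blockPositions n K i a) := by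
  funext j
  simp only [replaceOn, blockPositions, Finset.mem_filter, Finset.mem_univ, true_and, blockDataset]
  by_cases h : (j : ℕ) / K < D
  · simp only [h, dif_pos]
    by_cases hi : (j : ℕ) / K = i
    · have : (⟨(j : ℕ) / K, h⟩ : Fin D) = i := Fin.ext hi
      simp [hi]
    · have : (⟨(j : ℕ) / K, h⟩ : Fin D) ≠ i := fun hc => hi (congrArg Fin.val hc)
      simp [this, hi]
  · have hi : (j : ℕ) / K ≠ i := fun hc => h (hc ▸ i.2)
    simp [h, hi]

theorem blockDataset_update_zero_of_mem {n K D : ℕ} (N : Fin D → Fin (K + 1)) (i : Fin D) {k : ℕ} {j : Fin n}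
    (hj : j ∈ blockPositions n K i k) : blockDataset n K (Function.update N i 0) j = 0 := by
  simp only [blockPositions, Finset.mem_filter, Finset.mem_univ, true_and] at hj
  have h : (j : ℕ) / K < D := hj.1 ▸ i.2
  have : (⟨(j : ℕ) / K, h⟩ : Fin D) = i := Fin.ext hj.1
  simp [blockDataset, h, this]

theorem le_card_blockDataset_eq_zero {n K D : ℕ} (hK : 0 < K) (N : Fin D → Fin (K + 1)) :
    n - D * K ≤ (Finset.univ.filter fun j => blockDataset n K N j = 0).card := by
  have h1 : ((Finset.univ.filter fun j : Fin n => ¬ blockDataset n K N j = 0).map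
      Fin.valEmbedding) ⊆ Finset.range (D * K) := by
    intro j hj
    simp only [Finset.mem_map, Finset.mem_filter, Finset.mem_univ, true_and,
      Fin.valEmbedding_apply] at hj
    obtain ⟨a, ha, rfl⟩ := hj
    rw [Finset.mem_range, ← Nat.div_lt_iff_lt_mul hK]
    by_contra hc
    exact ha (by simp [blockDataset, hc])
  have h2 := Finset.card_le_card h1
  rw [Finset.card_map, Finset.card_range] at h2
  have h3 := Finset.card_filter_add_card_filter_not (s := (Finset.univ : Finset (Fin n)))
    (fun j => blockDataset n K N j = 0)
  rw [Finset.card_univ, Fintype.card_fin] at h3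
  omega

theorem countDistinct_comp_perm {n : ℕ} {X : Type} (x : Fin n → X) (σ : Equiv.Perm (Fin n)) :
    PublicCoinLocalProtocol.countDistinct (x ∘ σ) = PublicCoinLocalProtocol.countDistinct x := by
  rw [PublicCoinLocalProtocol.countDistinct, PublicCoinLocalProtocol.countDistinct,
    σ.surjective.range_comp]

theorem countDistinct_blockDataset_le {n K D : ℕ} (N : Fin D → Fin (K + 1)) :
    PublicCoinLocalProtocol.countDistinct (blockDataset n K N) ≤
      (Finset.univ.filter fun i => N i ≠ 0).card + 1 := by
  have h1 : Set.range (blockDataset n K N) ⊆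
      ((insert 0 ((Finset.univ.filter fun i => N i ≠ 0).map (Fin.succEmb D)) : Finset _) :
        Set (Fin (D + 1))) := by
    rintro _ ⟨j, rfl⟩
    simp only [Finset.coe_insert, Finset.coe_map, Set.mem_insert_iff, Set.mem_image, Finset.mem_coe,
      Finset.mem_filter, Finset.mem_univ, true_and]
    by_cases h : (j : ℕ) / K < D
    · by_cases h2 : (j : ℕ) % K < N ⟨(j : ℕ) / K, h⟩
      · refine Or.inr ⟨⟨(j : ℕ) / K, h⟩, fun hc => ?_, ?_⟩
        · rw [hc] at h2
          simp at h2
        · simp [blockDataset, h, h2]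
      · simp [blockDataset, h, h2]
    · simp [blockDataset, h]
  calc _ ≤ Set.ncard ((insert 0 ((Finset.univ.filter fun i => N i ≠ 0).map (Fin.succEmb D)) :
        Finset (Fin (D + 1))) : Set (Fin (D + 1))) := Set.ncard_le_ncard h1 (Finset.finite_toSet _)
    _ = _ := Set.ncard_coe_finset _
    _ ≤ _ := Finset.card_insert_le _ _
    _ = _ := by rw [Finset.card_map]

theorem countDistinct_blockDataset_eq {n K D : ℕ} (hK : 0 < K) (hn : D * K < n) {N : Fin D → Fin (K + 1)}
    (hN : ∀ i, N i ≠ 0) : PublicCoinLocalProtocol.countDistinct (blockDataset n K N) = D + 1 := by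
  have h1 : Set.range (blockDataset n K N) = Set.univ := by
    rw [Set.eq_univ_iff_forall]
    intro c
    refine Fin.cases ?_ (fun i => ?_) c
    -- The strict inequality leaves a position after all blocks, so `0` always occurs.
    · refine ⟨⟨D * K, hn⟩, ?_⟩
      have : ¬ (D * K / K < D) := by rw [Nat.mul_div_cancel _ hK]; omega
      simp [blockDataset, this]
    · have hNi : 0 < (N i : ℕ) := Nat.pos_of_ne_zero fun h => hN i (Fin.ext h)
      have hlt : i * K < n := lt_of_le_of_lt (Nat.mul_le_mul_right _ i.2.le) hn
      refine ⟨⟨i * K, hlt⟩, ?_⟩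
      simp [blockDataset, Nat.mul_div_cancel _ hK, hNi]
  rw [PublicCoinLocalProtocol.countDistinct, h1, Set.ncard_univ, Nat.card_eq_fintype_card, Fintype.card_fin]

theorem replaceOn_comp_perm {ι X : Type*} [DecidableEq ι] (x : ι → X) (c : X) (T : Finset ι)
    (σ : Equiv.Perm ι) :
    replaceOn x c T ∘ σ = replaceOn (x ∘ σ) c (T.map σ.symm.toEmbedding) := by
  funext j
  have : j ∈ T.map σ.symm.toEmbedding ↔ σ j ∈ T := by
    simp [Finset.mem_map_equiv]
  simp only [replaceOn, Function.comp_apply, this]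

theorem comp_replaceOn {ι X Y : Type*} [DecidableEq ι] (r : X → Y) (x : ι → X) (c : X) (T : Finset ι) :
    (fun j => r (replaceOn x c T j)) = replaceOn (fun j => r (x j)) (r c) T := by
  funext j
  simp only [replaceOn]
  split_ifs <;> rfl

/-! ### The cost of exchanging one multiplicity. -/

/-- Orders up to `d` vanish. For `j > d` the moment is at most `2K^j` and the square root at most
`(4K)^(-j)`, leaving the geometric tail of `2 · 4^(-j)`. The constant `32` is what `2KC / m ≤ 1 /
(4K)²` requires. -/
theorem sum_range_mul_sqrt_le {d K m : ℕ} {C : ℝ} (hC : 1 ≤ C) (hK : 1 ≤ K)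
    (hm : 32 * C * (K : ℝ) ^ 3 ≤ m) {w : ℕ → ℝ} (hw : ∑ k ∈ Finset.range (K + 1), |w k| ≤ 2)
    (hw0 : ∀ j ≤ d, ∑ k ∈ Finset.range (K + 1), w k * (k.choose j : ℝ) = 0) :
    ∑ j ∈ Finset.range (K + 1), |∑ k ∈ Finset.range (K + 1), w k * (k.choose j : ℝ)| *
        Real.sqrt (C ^ j / (m.choose j : ℝ)) ≤ (1 / 4) ^ d := by
  have hK' : (1 : ℝ) ≤ K := by exact_mod_cast hK
  have hKm : 2 * K ≤ m := by
    have h1 : (K : ℝ) ≤ (K : ℝ) ^ 3 := le_self_pow₀ hK' (by norm_num)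
    have : ((2 * K : ℕ) : ℝ) ≤ m := by push_cast; nlinarith
    exact_mod_cast this
  have hterm : ∀ j ∈ Finset.range (K + 1), |∑ k ∈ Finset.range (K + 1), w k * (k.choose j : ℝ)| *
        Real.sqrt (C ^ j / (m.choose j : ℝ)) ≤ if j ∈ Finset.range (d + 1) then 0 else 2 * (1 / 4) ^ j := by
    intro j hj
    rw [Finset.mem_range] at hj
    split_ifs with hjd
    · rw [Finset.mem_range] at hjd
      rw [hw0 j (by omega), abs_zero, zero_mul]
    have h1 : |∑ k ∈ Finset.range (K + 1), w k * (k.choose j : ℝ)| ≤ 2 * (K : ℝ) ^ j := by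
      calc _ ≤ ∑ k ∈ Finset.range (K + 1), |w k * (k.choose j : ℝ)| := Finset.abs_sum_le_sum_abs _ _
        _ ≤ ∑ k ∈ Finset.range (K + 1), |w k| * (K : ℝ) ^ j := by
            refine Finset.sum_le_sum fun k hk => ?_
            rw [abs_mul, Nat.abs_cast]
            refine mul_le_mul_of_nonneg_left ?_ (abs_nonneg _)
            have h2 : k.choose j ≤ K ^ j := (Nat.choose_le_pow k j).trans
              (Nat.pow_le_pow_left (by rw [Finset.mem_range] at hk; omega) j)
            exact_mod_cast h2
        _ ≤ _ := by rw [← Finset.sum_mul]; gcongr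
    have h2 : ((m : ℝ) / (2 * K)) ^ j ≤ (m.choose j : ℝ) := by
      have h3 : ((m + 1 - j) ^ j : ℕ) ≤ j.factorial * m.choose j := by
        have h := Nat.pow_le_choose (α := ℝ) j m
        rw [div_le_iff₀ (by positivity), mul_comm] at h
        exact_mod_cast h
      have h4 : j.factorial ≤ K ^ j := (Nat.factorial_le_pow j).trans (Nat.pow_le_pow_left (by omega) j)
      have h5 : (((m + 1 - j) ^ j : ℕ) : ℝ) ≤ (K : ℝ) ^ j * (m.choose j : ℝ) := by
        exact_mod_cast h3.trans (Nat.mul_le_mul_right _ h4)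
      have h6 : (m : ℝ) / 2 ≤ ((m + 1 - j : ℕ) : ℝ) := by
        rw [Nat.cast_sub (by omega)]
        have : ((2 * j : ℕ) : ℝ) ≤ ((m + 2 : ℕ) : ℝ) := by exact_mod_cast (by omega)
        push_cast at this ⊢
        linarith
      have h7 : ((m : ℝ) / 2) ^ j ≤ (K : ℝ) ^ j * (m.choose j : ℝ) := by
        refine le_trans ?_ h5
        push_cast
        exact pow_le_pow_left₀ (by positivity) h6 j
      rw [← div_div, div_pow, div_le_iff₀ (by positivity), mul_comm]
      exact h7
    have hmpos : (0 : ℝ) < m := lt_of_lt_of_le (by positivity) hm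
    have h3 : Real.sqrt (C ^ j / (m.choose j : ℝ)) ≤ (1 / (4 * K)) ^ j := by
      rw [Real.sqrt_le_left (by positivity)]
      calc C ^ j / (m.choose j : ℝ) ≤ C ^ j / ((m : ℝ) / (2 * K)) ^ j := by gcongr
        _ = (C / ((m : ℝ) / (2 * K))) ^ j := (div_pow _ _ _).symm
        _ ≤ ((1 / (4 * K)) ^ 2) ^ j := by
            gcongr
            rw [div_le_iff₀ (by positivity)]
            field_simp
            nlinarith
        _ = _ := by rw [← pow_mul, ← pow_mul, mul_comm 2 j]
    calc _ ≤ 2 * (K : ℝ) ^ j * (1 / (4 * K)) ^ j := mul_le_mul h1 h3 (Real.sqrt_nonneg _) (by positivity)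
      _ = 2 * (1 / 4) ^ j := by
          rw [mul_assoc, ← mul_pow]
          congr 2
          field_simp
  refine (Finset.sum_le_sum hterm).trans ?_
  -- The subtracted `(1 / 4) ^ q` is the slack that closes the induction.
  have hgeo : ∀ q : ℕ, d ≤ q → ∑ j ∈ Finset.range (q + 1),
      (if j ∈ Finset.range (d + 1) then 0 else 2 * (1 / 4 : ℝ) ^ j) ≤ (1 / 4) ^ d - (1 / 4) ^ q := by
    intro q hq
    induction q, hq using Nat.le_induction with
    | base =>
      rw [Finset.sum_eq_zero fun j hj => by rw [if_pos hj], sub_self]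
    | succ q hq ih =>
      rw [Finset.sum_range_succ, if_neg (by simp; omega), pow_succ]
      have : (0 : ℝ) ≤ (1 / 4) ^ q := by positivity
      linarith
  rcases le_total d K with h | h
  · have := hgeo K h
    have h2 : (0 : ℝ) ≤ (1 / 4) ^ K := by positivity
    linarith
  · rw [Finset.sum_eq_zero]
    · positivity
    · intro j hj
      rw [if_pos (Finset.range_mono (by omega) hj)]

/-- This is one step of the hybrid argument. Shuffling replaces the block of element `i` by a
uniformly random subset of the zeros; the estimate for such averages then applies to each
permutation separately. -/
theorem abs_sum_sub_mul_symmetrized_update_le {n D d K : ℕ} {M : Type*} [MeasurableSpace M]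
    (R : Fin (D + 1) → Measure M) [∀ i, IsProbabilityMeasure (R i)] {C : ℝ} (hC : 1 ≤ C)
    (hR : ∀ i, i ≠ 0 → ∃ f : M → ℝ, Measurable f ∧ (∀ m, 0 ≤ f m) ∧ (∀ m, f m ≤ C) ∧
      R i = (R 0).withDensity fun m => ENNReal.ofReal (f m))
    {φ : (Fin n → M) → ℝ} (hφ : Measurable φ) (hφ1 : ∀ y, |φ y| ≤ 1) (hK : 1 ≤ K)
    (hn : 2 * (D * K) ≤ n) (hCn : 64 * C * (K : ℝ) ^ 3 ≤ n) {w : ℕ → ℝ}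
    (hw : ∑ k ∈ Finset.range (K + 1), |w k| ≤ 2)
    (hw0 : ∀ j ≤ d, ∑ k ∈ Finset.range (K + 1), w k * (k.choose j : ℝ) = 0)
    (i : Fin D) (N : Fin D → Fin (K + 1)) :
    |∑ a : Fin (K + 1), w a * ((∑ σ : Equiv.Perm (Fin n),
      ∫ y, φ y ∂Measure.pi fun j => R ((blockDataset n K (Function.update N i a) ∘ σ) j)) /
        (n.factorial : ℝ))| ≤ (1 / 4) ^ d := by
  set x := blockDataset n K (Function.update N i 0) with hx
  set F := Finset.univ.filter fun j => x j = 0 with hF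
  set Φ : (Fin n → Fin (D + 1)) → ℝ := fun x' => ∫ y, φ y ∂Measure.pi fun j => R (x' j) with hΦ
  have hxF : ∀ j ∈ F, x j = 0 := fun j hj => (Finset.mem_filter.1 hj).2
  -- The blocks cover at most half of the positions, so at least `n / 2` entries are `0`; this turns
  -- `64` into `32`.
  have hm : 32 * C * (K : ℝ) ^ 3 ≤ F.card := by
    have h1 : n ≤ 2 * F.card := by
      have := le_card_blockDataset_eq_zero (n := n) hK (Function.update N i 0)
      change n - D * K ≤ F.card at this
      omega
    have h2 : (n : ℝ) ≤ 2 * F.card := by exact_mod_cast h1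
    linarith
  have hKF : K ≤ F.card := by
    have hK' : (1 : ℝ) ≤ K := by exact_mod_cast hK
    have h1 : (K : ℝ) ≤ (K : ℝ) ^ 3 := le_self_pow₀ hK' (by norm_num)
    have : (K : ℝ) ≤ F.card := by nlinarith
    exact_mod_cast this
  have hsym : ∀ a : Fin (K + 1), ∑ σ : Equiv.Perm (Fin n),
      Φ (blockDataset n K (Function.update N i a) ∘ σ) =
      ∑ σ : Equiv.Perm (Fin n), (∑ S ∈ F.powersetCard a, Φ (replaceOn x i.succ S ∘ σ)) /
        (F.card.choose a : ℝ) := by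
    intro a
    have hcard := card_blockPositions (n := n) (K := K) (by omega) i (Nat.lt_succ_iff.1 a.2)
    have := sum_perm_replaceOn_eq Φ x (Fin.succ_ne_zero i).symm hxF
      (T := blockPositions n K i a) fun j hj =>
        Finset.mem_filter.2 ⟨Finset.mem_univ _, blockDataset_update_zero_of_mem N i hj⟩
    rw [hcard] at this
    rw [← this, blockDataset_update]
  have hσ : ∀ σ : Equiv.Perm (Fin n), |∑ k ∈ Finset.range (K + 1), w k *
      ((∑ S ∈ F.powersetCard k, Φ (replaceOn x i.succ S ∘ σ)) / (F.card.choose k : ℝ))| ≤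
        (1 / 4) ^ d := by
    intro σ
    obtain ⟨f, hf, hf0, hfC, hfR⟩ := hR i.succ (Fin.succ_ne_zero i)
    have h1 := abs_sum_mul_average_le (fun j => R ((x ∘ σ) j)) hf hf0 hfC hfR
      (F := F.map σ.symm.toEmbedding) (fun j hj => by
        rw [Finset.mem_map_equiv, Equiv.symm_symm] at hj
        simp only [Function.comp_apply]
        rw [hxF _ hj]) hφ hφ1 w (K := K) (by rw [Finset.card_map]; exact hKF)
    rw [Finset.card_map] at h1
    refine le_trans (le_of_eq ?_) (h1.trans (sum_range_mul_sqrt_le hC hK hm hw hw0))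
    congr 1
    refine Finset.sum_congr rfl fun k _ => ?_
    rw [Finset.powersetCard_map, Finset.sum_map]
    congr 2
    refine Finset.sum_congr rfl fun S _ => ?_
    simp only [hΦ, replaceOn_comp_perm, RelEmbedding.coe_toEmbedding, Finset.mapEmbedding_apply]
    rw [comp_replaceOn R]
  have hfact : (0 : ℝ) < (n.factorial : ℝ) := by positivity
  have hall : ∑ a : Fin (K + 1), w a * ((∑ σ : Equiv.Perm (Fin n),
      Φ (blockDataset n K (Function.update N i a) ∘ σ)) / (n.factorial : ℝ)) =
      (∑ σ : Equiv.Perm (Fin n), ∑ k ∈ Finset.range (K + 1), w k *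
      ((∑ S ∈ F.powersetCard k, Φ (replaceOn x i.succ S ∘ σ)) / (F.card.choose k : ℝ))) /
        (n.factorial : ℝ) := by
    rw [Finset.sum_comm, Finset.sum_div, Finset.sum_range]
    refine Finset.sum_congr rfl fun a _ => ?_
    rw [hsym a, ← Finset.mul_sum, mul_div_assoc]
  change |∑ a : Fin (K + 1), w a * ((∑ σ : Equiv.Perm (Fin n),
      Φ (blockDataset n K (Function.update N i a) ∘ σ)) / (n.factorial : ℝ))| ≤ _
  rw [hall, abs_div, abs_of_pos hfact, div_le_iff₀ hfact]
  refine (Finset.abs_sum_le_sum_abs _ _).trans ((Finset.sum_le_sum fun σ _ => hσ σ).trans_eq ?_)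
  rw [Finset.sum_const, Finset.card_univ, Fintype.card_perm, Fintype.card_fin, nsmul_eq_mul, mul_comm]

/-! ### Indistinguishability contradicts accuracy. -/

/-- The Markov inequality for the number of nonzero coordinates of a product distribution. -/
theorem one_third_le_sum_prod {D K : ℕ} (hD : 1 ≤ D) {u : Fin (K + 1) → ℝ} (hu : ∀ a, 0 ≤ u a)
    (hu1 : ∑ a, u a = 1) (hu0 : 1 / 2 ≤ u 0) :
    1 / 3 ≤ ∑ N : Fin D → Fin (K + 1), (∏ i, u (N i)) *
      if ((Finset.univ.filter fun i => N i ≠ 0).card : ℝ) ≤ 3 / 4 * D then 1 else 0 := by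
  have hD' : (1 : ℝ) ≤ D := by exact_mod_cast hD
  have hone : ∑ N : Fin D → Fin (K + 1), ∏ i, u (N i) = 1 := by
    rw [← Fintype.prod_sum]; simp [hu1]
  have hmarg : ∀ i : Fin D, ∑ N : Fin D → Fin (K + 1), (∏ j, u (N j)) * (if N i ≠ 0 then 1 else 0) =
      1 - u 0 := by
    intro i
    have h1 : ∀ N : Fin D → Fin (K + 1), (∏ j, u (N j)) * (if N i ≠ 0 then 1 else 0) =
        ∏ j, u (N j) * (if j = i then (if N j ≠ 0 then 1 else 0) else 1) := by
      intro N
      rw [Finset.prod_mul_distrib, Finset.prod_ite_eq' Finset.univ i, if_pos (Finset.mem_univ i)]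
    rw [Finset.sum_congr rfl fun N _ => h1 N,
      ← Fintype.prod_sum (fun j a => u a * (if j = i then (if a ≠ 0 then 1 else 0) else 1)),
      Finset.prod_eq_single i]
    · have h2 : ∑ a, u a * (if a ≠ 0 then 1 else 0) = ∑ a, u a - u 0 := by
        simp [Fin.sum_univ_succ]
      simp only [if_true]
      rw [h2, hu1]
    · intro j _ hj
      simp [hj, hu1]
    · simp
  have hexp : ∑ N : Fin D → Fin (K + 1), (∏ j, u (N j)) *
      ((Finset.univ.filter fun i => N i ≠ 0).card : ℝ) = D * (1 - u 0) := by
    have h1 : ∀ N : Fin D → Fin (K + 1), (∏ j, u (N j)) *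
        ((Finset.univ.filter fun i => N i ≠ 0).card : ℝ) =
        ∑ i, (∏ j, u (N j)) * (if N i ≠ 0 then 1 else 0) := by
      intro N
      rw [← Finset.mul_sum, Finset.sum_boole]
    rw [Finset.sum_congr rfl fun N _ => h1 N, Finset.sum_comm, Finset.sum_congr rfl fun i _ => hmarg i,
      Finset.sum_const, Finset.card_univ, Fintype.card_fin, nsmul_eq_mul]
  -- The indicator is bounded below by an affine function of the count. The mean count is at most `D
  -- / 2`, so the expectation is at least `1 - 2 / 3`.
  have hle : ∑ N : Fin D → Fin (K + 1), (∏ j, u (N j)) *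
      (1 - 4 / (3 * D) * ((Finset.univ.filter fun i => N i ≠ 0).card : ℝ)) ≤
      ∑ N : Fin D → Fin (K + 1), (∏ i, u (N i)) *
        if ((Finset.univ.filter fun i => N i ≠ 0).card : ℝ) ≤ 3 / 4 * D then 1 else 0 := by
    refine Finset.sum_le_sum fun N _ => mul_le_mul_of_nonneg_left ?_ (Finset.prod_nonneg fun i _ => hu _)
    have h0 : (0 : ℝ) ≤ 4 / (3 * D) := by positivity
    split_ifs with h
    · have := mul_nonneg h0 (Nat.cast_nonneg (α := ℝ) (Finset.univ.filter fun i => N i ≠ 0).card)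
      linarith
    · push Not at h
      have := mul_le_mul_of_nonneg_left h.le h0
      have h2 : 4 / (3 * (D : ℝ)) * (3 / 4 * D) = 1 := by field_simp
      linarith
  refine le_trans ?_ hle
  have : ∑ N : Fin D → Fin (K + 1), (∏ j, u (N j)) *
      (1 - 4 / (3 * D) * ((Finset.univ.filter fun i => N i ≠ 0).card : ℝ)) =
      1 - 4 / (3 * D) * (D * (1 - u 0)) := by
    rw [← hexp, ← hone, Finset.mul_sum, ← Finset.sum_sub_distrib, hone]
    exact Finset.sum_congr rfl fun N _ => by ring
  rw [this]
  have h2 : 4 / (3 * (D : ℝ)) * (D * (1 - u 0)) = 4 / 3 * (1 - u 0) := by field_simp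
  rw [h2]
  linarith

theorem hasSum_mul_sum_mul_average {A S T : Type*} [Fintype S] [Fintype T] {r : A → ℝ} (c : T → ℝ)
    (G : A → T → S → ℝ) (p : T → S → ℝ) (z : ℝ) (h : ∀ t s, HasSum (fun a => r a * G a t s) (p t s)) :
    HasSum (fun a => r a * ∑ t, c t * ((∑ s, G a t s) / z)) (∑ t, c t * ((∑ s, p t s) / z)) := by
  have h1 : ∀ t, HasSum (fun a => c t * ((∑ s, r a * G a t s) / z)) (c t * ((∑ s, p t s) / z)) :=
    fun t => ((hasSum_sum fun s _ => h t s).div_const z).mul_left (c t)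
  have h2 : HasSum (fun a => ∑ t, c t * ((∑ s, r a * G a t s) / z)) (∑ t, c t * ((∑ s, p t s) / z)) :=
    hasSum_sum fun t _ => h1 t
  have h3 : (fun a => r a * ∑ t, c t * ((∑ s, G a t s) / z)) =
      fun a => ∑ t, c t * ((∑ s, r a * G a t s) / z) := by
    funext a
    rw [Finset.mul_sum]
    refine Finset.sum_congr rfl fun t _ => ?_
    rw [← Finset.mul_sum]
    ring
  rw [h3]
  exact h2

namespace PublicCoinLocalProtocol

variable {n : ℕ} {M : Type u} [MeasurableSpace M]

/-- A private protocol does not count distinct elements, for explicit ranges of the parameters. -/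
theorem IsLocallyDP.not_solvesCountDistinct {D d : ℕ} {P : PublicCoinLocalProtocol n (Fin (D + 1)) M}
    {ε δ e : ℝ} (hP : P.IsLocallyDP ε δ) (hD : 1 ≤ D) (hn : 2 * (D * (4 * d ^ 2 + 1)) ≤ n)
    (hε : 64 * (2 * Real.exp ε + 1) * ((4 * d ^ 2 + 1 : ℕ) : ℝ) ^ 3 ≤ n)
    (hd : D * (1 / 4 : ℝ) ^ d ≤ 1 / 20) (hδ : 2 * n * δ ≤ 1 / 20) (he : e + 1 ≤ D / 8) :
    ¬ P.SolvesCountDistinct e := by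
  intro hS
  obtain ⟨R, hRp, hRd, hRo⟩ := hP.exists_dominated (0 : Fin (D + 1))
  obtain ⟨u, v, hu, hv, hu1, hv1, hv0, hu0, huv⟩ := exists_moment_matching_weights d
  set K := 4 * d ^ 2 + 1 with hK
  have hK1 : 1 ≤ K := by omega
  have hDK : 1 ≤ D * K := Nat.mul_pos hD hK1
  change ∑ k ∈ Finset.range (K + 1), u k = 1 at hu1
  change ∑ k ∈ Finset.range (K + 1), v k = 1 at hv1
  change ∀ j ≤ d, ∑ k ∈ Finset.range (K + 1), (u k - v k) * (k.choose j : ℝ) = 0 at huv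
  have hw2 : ∑ k ∈ Finset.range (K + 1), |u k - v k| ≤ 2 := by
    calc _ ≤ ∑ k ∈ Finset.range (K + 1), (u k + v k) := Finset.sum_le_sum fun k _ =>
          abs_le.2 ⟨by linarith [hu k, hv k], by linarith [hu k, hv k]⟩
      _ = 2 := by rw [Finset.sum_add_distrib, hu1, hv1]; norm_num
  have hu1' : ∑ a : Fin (K + 1), u a = 1 := by rw [← hu1, Finset.sum_range]
  have hv1' : ∑ a : Fin (K + 1), v a = 1 := by rw [← hv1, Finset.sum_range]
  have hmarkov := P.markov
  -- Since `e + 1 ≤ D / 8`, accurate answers are at most `7D / 8` when the count is at most `3D / 4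
  -- + 1`, and at least `7D / 8 + 2` when it is `D + 1`.
  set E : Set ℝ := {t | t ≤ 7 / 8 * D + 1 / 2} with hE
  have hEm : MeasurableSet E := measurableSet_Iic
  set φ : List Bool → (Fin n → M) → ℝ := fun a y => (P.A a y).real E with hφ
  have hφm : ∀ a, Measurable (φ a) := fun a => ((P.A a).measurable_coe hEm).ennreal_toReal
  have hφ0 : ∀ a y, 0 ≤ φ a y := fun a y => measureReal_nonneg
  have hφ1 : ∀ a y, φ a y ≤ 1 := fun a y => measureReal_le_one
  set q : List Bool → (Fin n → Fin (D + 1)) → ℝ := fun a x =>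
    ∫ y, φ a y ∂Measure.pi fun j => R a (x j) with hq
  have hqi : ∀ a (x : Fin n → Fin (D + 1)), Integrable (φ a) (Measure.pi fun j => R a (x j)) := fun a x =>
    Integrable.of_bound (hφm a).aestronglyMeasurable 1 (Eventually.of_forall fun y => by
      rw [Real.norm_of_nonneg (hφ0 a y)]; exact hφ1 a y)
  have hq0 : ∀ a x, 0 ≤ q a x := fun a x => integral_nonneg (hφ0 a)
  have hq1 : ∀ a x, q a x ≤ 1 := fun a x =>
    (integral_mono (hqi a x) (integrable_const 1) (hφ1 a)).trans_eq (by simp)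
  set pr : List Bool → ℝ := fun a => (P.pub a).toReal with hpr
  have hprs : HasSum pr 1 := by
    have h := P.pub.tsum_coe
    have h2 : HasSum (fun a => (P.pub a).toReal) (∑' a, (P.pub a).toReal) :=
      (ENNReal.summable_toReal P.pub.tsum_coe_ne_top).hasSum
    rwa [← ENNReal.tsum_toReal_eq fun a => P.pub.apply_ne_top a, h, ENNReal.toReal_one] at h2
  have hpr0 : ∀ a, 0 ≤ pr a := fun a => ENNReal.toReal_nonneg
  set p : (Fin n → Fin (D + 1)) → ℝ := fun x => ∑' a, pr a * q a x with hp
  have hps : ∀ x, HasSum (fun a => pr a * q a x) (p x) := fun x =>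
    (Summable.of_nonneg_of_le (fun a => mul_nonneg (hpr0 a) (hq0 a x))
      (fun a => mul_le_of_le_one_right (hpr0 a) (hq1 a x)) hprs.summable).hasSum
  have hsmall : ENNReal.ofReal (2 * n * δ) ≤ ENNReal.ofReal (1 / 20) := ENNReal.ofReal_le_ofReal hδ
  have hlint : ∀ x : Fin n → Fin (D + 1), ∑' a, P.pub a * ∫⁻ y, P.A a y E ∂Measure.pi (fun i => R a (x i)) =
      ENNReal.ofReal (p x) := by
    intro x
    rw [hp, ENNReal.ofReal_tsum_of_nonneg (fun a => mul_nonneg (hpr0 a) (hq0 a x)) (hps x).summable]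
    refine tsum_congr fun a => ?_
    rw [ENNReal.ofReal_mul (hpr0 a), hpr, ENNReal.ofReal_toReal (P.pub.apply_ne_top a), hq,
      ofReal_integral_eq_lintegral_ofReal (hqi a x) (Eventually.of_forall (hφ0 a))]
    congr 1
    refine lintegral_congr fun y => ?_
    rw [hφ, ofReal_measureReal]
  have hlintc : ∀ x : Fin n → Fin (D + 1), ∑' a, P.pub a * ∫⁻ y, P.A a y Eᶜ ∂Measure.pi (fun i => R a (x i)) =
      ENNReal.ofReal (1 - p x) := by
    intro x
    have h1 : HasSum (fun a => pr a * (1 - q a x)) (1 - p x) := by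
      simp_rw [mul_sub, mul_one]
      exact hprs.sub (hps x)
    rw [← h1.tsum_eq, ENNReal.ofReal_tsum_of_nonneg
      (fun a => mul_nonneg (hpr0 a) (sub_nonneg.2 (hq1 a x))) h1.summable]
    refine tsum_congr fun a => ?_
    rw [ENNReal.ofReal_mul (hpr0 a), hpr, ENNReal.ofReal_toReal (P.pub.apply_ne_top a), hq]
    have h2 : 1 - ∫ y, φ a y ∂Measure.pi (fun j => R a (x j)) =
        ∫ y, (1 - φ a y) ∂Measure.pi (fun j => R a (x j)) := by
      rw [integral_sub (integrable_const _) (hqi a x)]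
      simp
    simp only
    rw [h2, ofReal_integral_eq_lintegral_ofReal (f := fun y => 1 - φ a y) ((integrable_const _).sub (hqi a x))
      (Eventually.of_forall fun y => sub_nonneg.2 (hφ1 a y))]
    congr 1
    refine lintegral_congr fun y => ?_
    rw [← probReal_compl_eq_one_sub hEm, ofReal_measureReal]
  -- Here `0.94 = 0.99 - 1 / 20`, where `1 / 20` pays for the truncation of the randomizers.
  have hfew : ∀ x : Fin n → Fin (D + 1), (countDistinct x : ℝ) ≤ 3 / 4 * D + 1 → 94 / 100 ≤ p x := by
    intro x hx
    have h1 := (hS x).trans ((measure_mono fun t ht => ?_).trans (hRo x E hEm))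
    · rw [hlint] at h1
      have h2 := h1.trans (add_le_add_right hsmall _)
      rw [← ENNReal.ofReal_add ((tsum_nonneg fun a => mul_nonneg (hpr0 a) (hq0 a x))) (by norm_num),
        ENNReal.ofReal_le_ofReal_iff'] at h2
      rcases h2 with h2 | h2 <;> linarith
    · simp only [Set.mem_ofPred_eq, hE] at ht ⊢
      have := (abs_le.1 ht).2
      linarith
  have hmany : ∀ x : Fin n → Fin (D + 1), countDistinct x = D + 1 → p x ≤ 6 / 100 := by
    intro x hx
    have h1 := (hS x).trans ((measure_mono fun t ht => ?_).trans (hRo x Eᶜ hEm.compl))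
    · rw [hlintc] at h1
      have h2 := h1.trans (add_le_add_right hsmall _)
      have hp1 : p x ≤ 1 := by
        rw [← hprs.tsum_eq]
        exact hasSum_le (fun a => mul_le_of_le_one_right (hpr0 a) (hq1 a x)) (hps x) hprs.summable.hasSum
      rw [← ENNReal.ofReal_add (sub_nonneg.2 hp1) (by norm_num),
        ENNReal.ofReal_le_ofReal_iff'] at h2
      rcases h2 with h2 | h2 <;> linarith
    · simp only [Set.mem_ofPred_eq, hE, Set.mem_compl_iff, not_le] at ht ⊢
      rw [hx] at ht
      push_cast at ht
      have := (abs_le.1 ht).1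
      linarith
  have hfact : (0 : ℝ) < (n.factorial : ℝ) := by positivity
  set ψ : (Fin D → Fin (K + 1)) → ℝ := fun N =>
    (∑ σ : Equiv.Perm (Fin n), p (blockDataset n K N ∘ σ)) / (n.factorial : ℝ) with hψ
  have hψlow : ∀ N, ((Finset.univ.filter fun i => N i ≠ 0).card : ℝ) ≤ 3 / 4 * D → 94 / 100 ≤ ψ N := by
    intro N hN
    rw [hψ, le_div_iff₀ hfact]
    calc _ = ∑ σ : Equiv.Perm (Fin n), (94 / 100 : ℝ) := by
          rw [Finset.sum_const, Finset.card_univ, Fintype.card_perm, Fintype.card_fin, nsmul_eq_mul, mul_comm]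
      _ ≤ _ := Finset.sum_le_sum fun σ _ => hfew _ <| by
          rw [countDistinct_comp_perm]
          have : (countDistinct (blockDataset n K N) : ℝ) ≤
              (Finset.univ.filter fun i => N i ≠ 0).card + 1 := by
            exact_mod_cast countDistinct_blockDataset_le N
          linarith
  have hp0 : ∀ x, 0 ≤ p x := fun x => tsum_nonneg fun a => mul_nonneg (hpr0 a) (hq0 a x)
  have hψ0 : ∀ N, 0 ≤ ψ N := fun N =>
    div_nonneg (Finset.sum_nonneg fun σ _ => hp0 _) hfact.le
  have hψhigh : ∀ N, (∀ i, N i ≠ 0) → ψ N ≤ 6 / 100 := by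
    intro N hN
    rw [hψ, div_le_iff₀ hfact]
    calc _ ≤ ∑ σ : Equiv.Perm (Fin n), (6 / 100 : ℝ) := Finset.sum_le_sum fun σ _ => hmany _ <| by
          rw [countDistinct_comp_perm]
          exact countDistinct_blockDataset_eq hK1 (by omega) hN
      _ = _ := by
          rw [Finset.sum_const, Finset.card_univ, Fintype.card_perm, Fintype.card_fin, nsmul_eq_mul, mul_comm]
  have hU : 1 / 3 * (94 / 100) ≤ ∑ N : Fin D → Fin (K + 1), (∏ i, u (N i)) * ψ N := by
    have h1 := one_third_le_sum_prod (K := K) (u := fun a => u a) hD (fun a => hu a) hu1' (by simpa using hu0)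
    refine (mul_le_mul_of_nonneg_right h1 (by norm_num)).trans ?_
    rw [Finset.sum_mul]
    refine Finset.sum_le_sum fun N _ => ?_
    rw [mul_assoc]
    refine mul_le_mul_of_nonneg_left ?_ (Finset.prod_nonneg fun i _ => hu _)
    split_ifs with h
    · rw [one_mul]; exact hψlow N h
    · rw [zero_mul]; exact hψ0 N
  have hV : ∑ N : Fin D → Fin (K + 1), (∏ i, v (N i)) * ψ N ≤ 6 / 100 := by
    calc _ ≤ ∑ N : Fin D → Fin (K + 1), (∏ i, v (N i)) * (6 / 100) := by
          refine Finset.sum_le_sum fun N _ => ?_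
          by_cases hN : ∀ i, N i ≠ 0
          · exact mul_le_mul_of_nonneg_left (hψhigh N hN) (Finset.prod_nonneg fun i _ => hv _)
          · push Not at hN
            obtain ⟨i, hi⟩ := hN
            have : ∏ i, v (N i) = 0 := Finset.prod_eq_zero (Finset.mem_univ i) (by simp [hi, hv0])
            simp [this]
      _ = 6 / 100 := by
          rw [← Finset.sum_mul, ← Fintype.prod_sum (fun _ a => v (Fin.val a))]
          simp [hv1']
  -- The hybrid bound holds for each value of the coins, hence on average. The gap `0.94 / 3 - 0.06`
  -- exceeds `1 / 20`.
  have hcoin : ∀ a, |∑ N : Fin D → Fin (K + 1), ((∏ i, u (N i)) - ∏ i, v (N i)) *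
      ((∑ σ : Equiv.Perm (Fin n), q a (blockDataset n K N ∘ σ)) / (n.factorial : ℝ))| ≤ 1 / 20 := by
    intro a
    refine le_trans ?_ hd
    refine abs_sum_prod_sub_prod_mul_le (u := fun k : Fin (K + 1) => u k) (v := fun k : Fin (K + 1) => v k)
      (fun k => hu k) (fun k => hv k) hu1' hv1' D _ fun i N => ?_
    exact abs_sum_sub_mul_symmetrized_update_le (R a) (C := 2 * Real.exp ε + 1)
      (by linarith [Real.exp_pos ε]) (hRd a) (hφm a)
      (fun y => by rw [abs_of_nonneg (hφ0 a y)]; exact hφ1 a y) hK1 hn hε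
      (w := fun k => u k - v k) hw2 huv i N
  have hsum : HasSum (fun a => pr a * ∑ N : Fin D → Fin (K + 1), ((∏ i, u (N i)) - ∏ i, v (N i)) *
      ((∑ σ : Equiv.Perm (Fin n), q a (blockDataset n K N ∘ σ)) / (n.factorial : ℝ)))
      (∑ N : Fin D → Fin (K + 1), ((∏ i, u (N i)) - ∏ i, v (N i)) * ψ N) :=
    hasSum_mul_sum_mul_average _ (fun a N (σ : Equiv.Perm (Fin n)) => q a (blockDataset n K N ∘ σ))
      (fun N σ => p (blockDataset n K N ∘ σ)) _ fun N σ => hps _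
  have hle := hasSum_le (fun a => mul_le_mul_of_nonneg_left (le_of_abs_le (hcoin a)) (hpr0 a)) hsum
    (hprs.mul_right (1 / 20))
  simp_rw [sub_mul] at hle
  rw [Finset.sum_sub_distrib] at hle
  linarith

end PublicCoinLocalProtocol

/-! ### Choice of parameters and asymptotics. -/

theorem eventually_mul_log_pow_le (c : ℝ) (k : ℕ) : ∀ᶠ n : ℕ in atTop, c * Real.log n ^ k ≤ n := by
  have h1 : (fun n : ℕ => Real.log n ^ k) =o[atTop] fun n : ℕ => (n : ℝ) :=
    (Real.isLittleO_pow_log_id_atTop (n := k)).comp_tendsto tendsto_natCast_atTop_atTop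
  have hc : 0 < (|c| + 1)⁻¹ := by positivity
  filter_upwards [h1.bound hc] with n hn
  rw [Real.norm_of_nonneg (Nat.cast_nonneg n), inv_mul_eq_div, le_div_iff₀ (by positivity)] at hn
  calc c * Real.log n ^ k ≤ |c * Real.log n ^ k| := le_abs_self _
    _ = ‖Real.log n ^ k‖ * |c| := by rw [abs_mul, mul_comm, Real.norm_eq_abs]
    _ ≤ ‖Real.log n ^ k‖ * (|c| + 1) := by gcongr; linarith
    _ ≤ n := hn

theorem eventually_le_log_natCast (c : ℝ) : ∀ᶠ n : ℕ in atTop, c ≤ Real.log n :=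
  (Real.tendsto_log_atTop.comp tendsto_natCast_atTop_atTop).eventually_ge_atTop c

theorem IsSuperpolynomiallySmall.eventually_two_mul_le {δ : ℕ → ℝ} (hδ : IsSuperpolynomiallySmall δ) :
    ∀ᶠ n : ℕ in atTop, 2 * n * δ n ≤ 1 / 20 := by
  obtain ⟨g, hg, hδg⟩ := hδ
  filter_upwards [hδg, hg.eventually_ge_atTop 2, eventually_ge_atTop 40] with n h1 h2 h3
  have hn : (40 : ℝ) ≤ n := by exact_mod_cast h3
  have h4 : δ n ≤ (n : ℝ) ^ (-2 : ℝ) :=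
    h1.trans (Real.rpow_le_rpow_of_exponent_le (by linarith) (by linarith))
  rw [Real.rpow_neg (by linarith), Real.rpow_two] at h4
  calc 2 * n * δ n ≤ 2 * n * ((n : ℝ) ^ 2)⁻¹ := by gcongr
    _ = 2 / n := by field_simp
    _ ≤ 1 / 20 := by rw [div_le_div_iff₀ (by linarith) (by norm_num)]; linarith

theorem exp_log_sub_mul_log_log {n : ℕ} (hn : 0 < n) (hL : 0 < Real.log n) :
    Real.exp (Real.log n - 7 * Real.log (Real.log n)) = n / Real.log n ^ 7 := by
  rw [Real.exp_sub, Real.exp_log (by exact_mod_cast hn),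
    show (7 : ℝ) * Real.log (Real.log n) = Real.log (Real.log n ^ 7) by
      rw [Real.log_pow]; norm_num, Real.exp_log (by positivity)]

theorem isTheta_floor_div_log_pow (k : ℕ) :
    (fun n : ℕ => (⌊(n : ℝ) / Real.log n ^ k⌋₊ : ℝ)) =Θ[atTop]
      fun n : ℕ => (n : ℝ) / Real.log n ^ k := by
  have h2 : ∀ᶠ n : ℕ in atTop, 0 < Real.log n ∧ 2 ≤ (n : ℝ) / Real.log n ^ k := by
    filter_upwards [eventually_le_log_natCast 1, eventually_mul_log_pow_le 2 k] with n h1 h2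
    have : 0 < Real.log n := by linarith
    exact ⟨this, by rwa [le_div_iff₀ (by positivity)]⟩
  constructor
  · refine IsBigO.of_bound 1 ?_
    filter_upwards [h2] with n hn
    rw [Real.norm_of_nonneg (by positivity), Real.norm_of_nonneg (by linarith), one_mul]
    exact Nat.floor_le (by linarith)
  · refine IsBigO.of_bound 2 ?_
    filter_upwards [h2] with n hn
    rw [Real.norm_of_nonneg (by linarith), Real.norm_of_nonneg (by positivity)]
    have := Nat.lt_floor_add_one ((n : ℝ) / Real.log n ^ k)
    linarith

theorem natCast_mul_inv_four_pow_le {n D d : ℕ} (hn : 0 < n) (hd : Real.log n ≤ d)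
    (hD : (D : ℝ) ≤ n / 20) : D * (1 / 4 : ℝ) ^ d ≤ 1 / 20 := by
  have hn' : (0 : ℝ) < n := by exact_mod_cast hn
  have h1 : (n : ℝ) ≤ 4 ^ d := by
    calc (n : ℝ) = Real.exp (Real.log n) := (Real.exp_log hn').symm
      _ ≤ Real.exp d := Real.exp_le_exp.2 hd
      _ = Real.exp 1 ^ d := by rw [← Real.exp_nat_mul, mul_one]
      _ ≤ 4 ^ d := by
          gcongr
          linarith [Real.exp_one_lt_d9]
  rw [div_pow, one_pow, mul_one_div, div_le_iff₀ (by positivity)]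
  linarith

theorem theorem2 :
    ∃ (ε : ℕ → ℝ) (D : ℕ → ℕ) (k : ℕ),
      -- `ε = ln n - O(ln ln n)`
      (∀ᶠ n : ℕ in atTop, ε n ≤ Real.log n) ∧
      ((fun n : ℕ => Real.log n - ε n) =O[atTop] fun n : ℕ => Real.log (Real.log n)) ∧
      -- `D = Θ(n / polylog n)`
      ((fun n : ℕ => (D n : ℝ)) =Θ[atTop] fun n : ℕ => (n : ℝ) / Real.log n ^ k) ∧
      -- no `(ε, n ^ (-ω(1)))`-locally DP protocol has error `o(D)`
      ∀ δ : ℕ → ℝ, IsSuperpolynomiallySmall δ →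
      ∀ e : ℕ → ℝ, e =o[atTop] (fun n : ℕ => (D n : ℝ)) →
      ∀ᶠ n : ℕ in atTop,
        ∀ (M : Type u) [MeasurableSpace M] (P : PublicCoinLocalProtocol n (Fin (D n)) M),
          P.IsLocallyDP (ε n) (δ n) → ¬ P.SolvesCountDistinct (e n) := by
  -- Write `L = ln n`. Since `K` is of order `L²`, the requirements are that `e^ε L^6` and `D L²` be
  -- at most small multiples of `n`. The exponents `7` and `3` each leave one factor `L` to absorb
  -- the constants.
  refine ⟨fun n => Real.log n - 7 * Real.log (Real.log n), fun n => ⌊(n : ℝ) / Real.log n ^ 3⌋₊, 3,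
    ?_, ?_, isTheta_floor_div_log_pow 3, ?_⟩
  · filter_upwards [eventually_le_log_natCast 1] with n hn
    have := Real.log_nonneg hn
    linarith
  · simp only [sub_sub_cancel]
    exact (isBigO_refl _ _).const_mul_left 7
  intro δ hδ e he
  -- With `K ≤ 20L²`, the privacy requirement is at most `1024000 n / L + 512000 L^6`, and each term
  -- has to be at most `n / 2`.
  filter_upwards [eventually_le_log_natCast 2048000, eventually_mul_log_pow_le 1024000 6,
    eventually_mul_log_pow_le 100 3, hδ.eventually_two_mul_le,
    he.bound (by norm_num : (0 : ℝ) < 1 / 16), eventually_gt_atTop 0] with n hL hn6 hn3 hδn hen hn0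
  have hn0' : (0 : ℝ) < n := by exact_mod_cast hn0
  set L := Real.log n with hLdef
  have hL0 : 0 < L := by linarith
  have hDle : (⌊(n : ℝ) / L ^ 3⌋₊ : ℝ) ≤ n / L ^ 3 := Nat.floor_le (by positivity)
  have hDge : (100 : ℝ) ≤ ⌊(n : ℝ) / L ^ 3⌋₊ := by
    have : 100 ≤ ⌊(n : ℝ) / L ^ 3⌋₊ :=
      Nat.le_floor (by rw [le_div_iff₀ (by positivity)]; exact_mod_cast hn3)
    exact_mod_cast this
  have hexp := exp_log_sub_mul_log_log hn0 hL0
  generalize ⌊(n : ℝ) / L ^ 3⌋₊ = D at hDle hDge hen ⊢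
  intro M _ P hP
  -- One element of the universe serves as the filler `0`; the other `D'` carry the random
  -- multiplicities.
  obtain ⟨D, rfl⟩ : ∃ D', D = D' + 1 :=
    ⟨D - 1, by have : 100 ≤ D := by exact_mod_cast hDge
               omega⟩
  push_cast at hDle hDge hen
  have hL3 : L ≤ L ^ 3 := le_self_pow₀ (by linarith) (by norm_num)
  set d := ⌈L⌉₊ with hd
  have hLd : L ≤ d := Nat.le_ceil L
  have hdL : (d : ℝ) ≤ 2 * L := by
    have := Nat.ceil_lt_add_one hL0.le
    linarith
  have hK : ((4 * d ^ 2 + 1 : ℕ) : ℝ) ≤ 20 * L ^ 2 := by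
    push_cast
    nlinarith
  refine hP.not_solvesCountDistinct (d := d) ?_ ?_ ?_ ?_ hδn ?_
  · have : (1 : ℝ) ≤ D := by linarith
    exact_mod_cast this
  · have h1 : ((2 * (D * (4 * d ^ 2 + 1)) : ℕ) : ℝ) ≤ n := by
      calc ((2 * (D * (4 * d ^ 2 + 1)) : ℕ) : ℝ) = 2 * (D * ((4 * d ^ 2 + 1 : ℕ) : ℝ)) := by push_cast; ring
        _ ≤ 2 * (n / L ^ 3 * (20 * L ^ 2)) := by gcongr; linarith
        _ = 40 * n / L := by field_simp; norm_num
        _ ≤ n := by rw [div_le_iff₀ hL0]; nlinarith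
    exact_mod_cast h1
  · rw [hexp]
    calc _ ≤ 64 * (2 * (n / L ^ 7) + 1) * (20 * L ^ 2) ^ 3 := by gcongr
      _ = 1024000 * n / L + 512000 * L ^ 6 := by field_simp; ring
      _ ≤ n / 2 + n / 2 := by
          refine add_le_add ?_ (by linarith)
          rw [div_le_iff₀ hL0]
          nlinarith
      _ = n := by ring
  · refine natCast_mul_inv_four_pow_le hn0 hLd ?_
    have h1 : (n : ℝ) / L ^ 3 ≤ n / 20 := by
      gcongr
      linarith
    linarith
  · rw [Real.norm_of_nonneg (by positivity : (0 : ℝ) ≤ (D : ℝ) + 1)] at hen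
    have := (le_abs_self (e n)).trans hen
    linarith
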